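/- Let $T$ be a tree with vertex set $V$, with no finiteness or countability assumption, and let $\Gamma$ be a (discrete) group acting on $T$ by graph automorphisms; inversions are allowed and the action need not be faithful. A ray is a sequence $(r_i)_{i\ge 0}$ of vertices with $d(r_i,r_{i+n})=n$ for all $i,n\ge 0$; rays $r,s$ are cofinal if there are $k,n\ge 0$ with $r_{i+k}=s_{i+n}$ for all $i\ge 0$; the boundary $\partial T$ is the set of cofinality classes of rays. For an oriented edge $e$ from $a$ to $b$ let $Z(e)\subseteq V\cup\partial T$ consist of the vertices closer to $b$ than to $a$ and of the classes of rays that traverse $e$ from $a$ to $b$. The shadow topology on $V\cup\partial T$ is the one with subbase $\{Z(e)\}_e$, and $\partial T$ carries the subspace topology; $\Gamma$ acts on $V\cup\partial T$ in the obvious way. An element $g\in\Gamma$ is hyperbolic if it fixes no vertex and reverses no edge. Assume that the action is minimal ($T$ has no proper $\Gamma$-invariant subtree) and strongly hyperbolic ($\Gamma$ contains two hyperbolic elements with no common fixed point in $V\cup\partial T$). For an action of $\Gamma$ on a topological space $X$ write $X^g=\{x\in X: gx=x\}$ and let $\operatorname{int}(\Gamma\curvearrowright X)$ be the subgroup of $\Gamma$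 generated by all $g$ for which $X^g$ has non-empty interior. The action is topologically free if $\operatorname{int}(\Gamma\curvearrowright X)=\{1\}$, and strongly faithful if for every finite set $F\subseteq\Gamma\setminus\{1\}$ there is $x\in X$ with $fx\ne x$ for all $f\in F$. The action on $T$ is slender if $(\partial T)^g$ has empty interior in $\partial T$ for every $g\ne 1$. A half-tree is one of the two components obtained by removing an edge from $T$; its fixator is the subgroup of all elements of $\Gamma$ fixing each of its vertices. Then the following are equivalent: 1. $\operatorname{int}(\Gamma\curvearrowright\partial T)=\{1\}$; 2. $\Gamma\curvearrowright T$ (that is, the action on $V$) is strongly faithful; 3. $\Gamma\curvearrowright\partial T$ is strongly faithful; 4. $\Gamma\curvearrowright\partial T$ is topologically free, i.e., $\Gamma\curvearrowright T$ is slender; 5. the fixators of all half-trees are trivial; 6. the fixator of some half-tree is trivial. If these conditions hold, then $\Gamma$ is a Powers group: $\Gamma\neq\{1\}$, and for every finite $F\subseteq\Gamma\setminus\{1\}$ and every integer $N\ge 1$ there are a partition $\Gamma=C\sqcup D$ and elements $\gamma_1,\dots,\gamma_N\in\Gamma$ with $fC\cap C=\emptyset$ for all $f\in F$ and $\gamma_jD\cap\gamma_kD=\emptyset$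 for all $j\ne k$. In particular $\Gamma$ is $C^*$-simple: the reduced group $C^*$-algebra $C^*_r(\Gamma)$, i.e. the $C^*$-subalgebra of $B(\ell^2(\Gamma))$ generated by the left regular representation, has no non-trivial proper closed two-sided ideal. -/

import Mathlib

namespace TreeAction

open scoped Pointwise

/-! ### Generalities on group actions -/

section Actions

variable (Γ : Type*) [Group Γ] (X : Type*) [MulAction Γ X]

/-- `int(Γ ↷ X)`: the subgroup generated by all `g` whose fixed-point set has non-empty interior. -/
def interiorSubgroup [TopologicalSpace X] : Subgroup Γ :=
  Subgroup.closure {g : Γ | (interior (MulAction.fixedBy X g)).Nonempty}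

/-- An action is topologically free if its interior `int(Γ ↷ X)` is trivial. -/
def IsTopologicallyFree [TopologicalSpace X] : Prop :=
  interiorSubgroup Γ X = ⊥

/-- An action is strongly faithful if every finite set of non-trivial group elements moves some
point simultaneously. -/
def IsStronglyFaithful : Prop :=
  ∀ F : Finset Γ, (1 : Γ) ∉ F → ∃ x : X, ∀ f ∈ F, f • x ≠ x

end Actions

/-! ### Trees, rays, the boundary and the shadow topology -/

section Tree

variable {V : Type*} (T : SimpleGraph V)

/-- `r₀, r₁, r₂, …` is a (geodesic) ray in `T`. -/
def IsRay (r : ℕ → V) : Prop :=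
  ∀ i n : ℕ, T.dist (r i) (r (i + n)) = n

/-- The type of rays in `T`. -/
def Ray : Type _ := {r : ℕ → V // IsRay T r}

/-- Cofinality of rays: after deleting suitable initial segments the two rays agree. -/
def raySetoid : Setoid (Ray T) where
  r x y := ∃ k n : ℕ, ∀ i : ℕ, x.1 (i + k) = y.1 (i + n)
  iseqv :=
    { refl := fun _ => ⟨0, 0, fun _ => rfl⟩
      symm := fun ⟨k, n, h⟩ => ⟨n, k, fun i => (h i).symm⟩
      trans := by
        rintro x y z ⟨k, n, h⟩ ⟨k', n', h'⟩
        refine ⟨k' + k, n + n', fun i => ?_⟩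
        have h1 := h (i + k')
        have h2 := h' (i + n)
        have e1 : i + (k' + k) = i + k' + k := by omega
        have e2 : i + k' + n = i + n + k' := by omega
        have e3 : i + (n + n') = i + n + n' := by omega
        rw [e1, h1, e2, h2, e3] }

/-- The boundary `∂T`: cofinality classes of rays. -/
def Boundary : Type _ := Quotient (raySetoid T)

/-- The space `T ∪ ∂T`, where `T` is identified with its set of vertices. -/
def Bordification : Type _ := V ⊕ Boundary T

/-- The shadow `Z₀(e)` of the oriented edge `e = (a, b)`: vertices closer to `b` than to `a`. -/
def shadow (a b : V) : Set V := {v | T.dist v b < T.dist v a}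

/-- The boundary shadow `Z_B(e)` of the oriented edge `e = (a, b)`: classes of rays that traverse
`e` from `a` to `b`. -/
def boundaryShadow (a b : V) : Set (Boundary T) :=
  {x | ∃ r : Ray T, (∃ j : ℕ, r.1 j = a ∧ r.1 (j + 1) = b) ∧ Quotient.mk (raySetoid T) r = x}

/-- The extended shadow `Z(e) = Z₀(e) ∪ Z_B(e)` of the oriented edge `e = (a, b)`. -/
def extendedShadow (a b : V) : Set (Bordification T) :=
  Sum.inl '' shadow T a b ∪ Sum.inr '' boundaryShadow T a b

/-- The shadow topology on `T ∪ ∂T`, with the extended shadows of the edges as a subbase. -/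
instance : TopologicalSpace (Bordification T) :=
  TopologicalSpace.generateFrom {U | ∃ a b : V, T.Adj a b ∧ U = extendedShadow T a b}

/-- The inclusion `∂T → T ∪ ∂T`. -/
def Boundary.toBordification (x : Boundary T) : Bordification T := Sum.inr x

/-- The shadow topology on `∂T`, as a subspace of `T ∪ ∂T`. -/
instance : TopologicalSpace (Boundary T) :=
  TopologicalSpace.induced (Boundary.toBordification T) inferInstance

/-- A half-tree is (the vertex set of) one of the components obtained by removing an edge. -/
def IsHalfTree (H : Set V) : Prop :=
  ∃ e ∈ T.edgeSet, ∃ c : (T.deleteEdges {e}).ConnectedComponent, H = c.supp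

end Tree

/-! ### Groups acting on trees -/

/-- `Γ` acts on the graph `T` by graph automorphisms; inversions are allowed. -/
class ActsOnGraph (Γ : Type*) [Group Γ] {V : Type*} [MulAction Γ V] (T : SimpleGraph V) :
    Prop where
  adj_smul : ∀ (g : Γ) (u v : V), T.Adj u v → T.Adj (g • u) (g • v)

section Action

variable {Γ : Type*} [Group Γ] {V : Type*} [MulAction Γ V] (T : SimpleGraph V) [ActsOnGraph Γ T]

/-- The graph automorphism given by a group element. -/
def toIso (g : Γ) : T ≃g T where
  toEquiv := MulAction.toPerm g
  map_rel_iff' := by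
    intro u v
    refine ⟨fun h => ?_, fun h => ActsOnGraph.adj_smul g u v h⟩
    have h' := ActsOnGraph.adj_smul (T := T) g⁻¹ _ _ h
    simpa using h'

theorem dist_smul_le (g : Γ) {u v : V} (h : T.Reachable u v) :
    T.dist (g • u) (g • v) ≤ T.dist u v := by
  obtain ⟨p, hp⟩ := h.exists_walk_length_eq_dist
  have := T.dist_le (p.map (toIso T g).toHom)
  rw [SimpleGraph.Walk.length_map, hp] at this
  exact this

theorem reachable_smul (g : Γ) {u v : V} (h : T.Reachable u v) :
    T.Reachable (g • u) (g • v) :=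
  h.map (toIso T g).toHom

theorem dist_smul (g : Γ) (u v : V) : T.dist (g • u) (g • v) = T.dist u v := by
  by_cases h : T.Reachable u v
  · apply le_antisymm (dist_smul_le T g h)
    simpa using dist_smul_le T g⁻¹ (reachable_smul T g h)
  · have h' : ¬ T.Reachable (g • u) (g • v) := fun h'' => h (by
      simpa using reachable_smul T g⁻¹ h'')
    rw [SimpleGraph.dist_eq_zero_of_not_reachable h,
      SimpleGraph.dist_eq_zero_of_not_reachable h']

/-- The image of a ray under a group element. -/
def Ray.smul (g : Γ) (r : Ray T) : Ray T :=
  ⟨fun i => g • r.1 i, fun i n => by rw [dist_smul]; exact r.2 i n⟩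

/-- The induced action on the boundary, `g • [(rᵢ)] = [(g • rᵢ)]`. -/
instance : MulAction Γ (Boundary T) where
  smul g := Quotient.map' (s₁ := raySetoid T) (s₂ := raySetoid T) (Ray.smul T g) (by
    rintro x y ⟨k, n, h⟩
    exact ⟨k, n, fun i => congrArg (g • ·) (h i)⟩)
  one_smul x := by
    refine Quotient.inductionOn x fun r => ?_
    exact congrArg (Quotient.mk (raySetoid T)) (Subtype.ext (funext fun i => one_smul Γ (r.1 i)))
  mul_smul g h x := by
    refine Quotient.inductionOn x fun r => ?_
    exact congrArg (Quotient.mk (raySetoid T)) (Subtype.ext (funext fun i => mul_smul g h (r.1 i)))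

/-- The induced action on `T ∪ ∂T`. -/
instance : MulAction Γ (Bordification T) where
  smul g := Sum.map (g • ·) (g • ·)
  one_smul x := by
    rcases x with v | x
    · exact congrArg Sum.inl (one_smul Γ v)
    · exact congrArg Sum.inr (one_smul Γ x)
  mul_smul g h x := by
    rcases x with v | x
    · exact congrArg Sum.inl (mul_smul g h v)
    · exact congrArg Sum.inr (mul_smul g h x)

/-- `g` is elliptic if it fixes a vertex. -/
def IsElliptic (V : Type*) [MulAction Γ V] (g : Γ) : Prop :=
  ∃ v : V, g • v = v

/-- `g` is an inversion if it fixes no vertex but reverses some edge. -/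
def IsInversion (g : Γ) : Prop :=
  ¬ IsElliptic V g ∧ ∃ u v : V, T.Adj u v ∧ g • u = v ∧ g • v = u

/-- `g` is hyperbolic if it is neither elliptic nor an inversion. -/
def IsHyperbolic (g : Γ) : Prop :=
  ¬ IsElliptic V g ∧ ¬ IsInversion T g

variable (Γ)

/-- The action on `T` is strongly hyperbolic if there are two transverse hyperbolic elements,
i.e. hyperbolic elements without common fixed point in `T ∪ ∂T`. -/
def IsStronglyHyperbolic : Prop :=
  ∃ g h : Γ, IsHyperbolic T g ∧ IsHyperbolic T h ∧
    Disjoint (MulAction.fixedBy (Bordification T) g) (MulAction.fixedBy (Bordification T) h)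

/-- The action on the tree `T` is minimal if `T` has no proper invariant subtree. A subtree of a
tree is determined by its vertex set, which is any non-empty set of vertices inducing a connected
subgraph. -/
def IsMinimalTreeAction : Prop :=
  ∀ S : Set V, (T.induce S).Connected → (∀ g : Γ, ∀ v ∈ S, g • v ∈ S) → S = Set.univ

/-- The action on `T` is slender if the fixed-point set in `∂T` of every non-trivial group element
has empty interior. -/
def IsSlender : Prop :=
  ∀ g : Γ, g ≠ 1 → interior (MulAction.fixedBy (Boundary T) g) = ∅

end Action

/-! ### Powers groups and C*-simplicity -/

section CStar

variable (Γ : Type*) [Group Γ]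

/-- A Powers group: a non-trivial group such that for every finite `F ⊆ Γ ∖ {1}` and every `N ≥ 1`
there are a partition `Γ = C ⊔ D` and `γ₁, …, γ_N ∈ Γ` with `f C ∩ C = ∅` for all `f ∈ F` and
`γⱼ D ∩ γₖ D = ∅` for all `j ≠ k`. -/
def IsPowersGroup : Prop :=
  Nontrivial Γ ∧ ∀ F : Finset Γ, (1 : Γ) ∉ F → ∀ N : ℕ, 1 ≤ N →
    ∃ (C D : Set Γ) (γ : Fin N → Γ), C ∪ D = Set.univ ∧ Disjoint C D ∧
      (∀ f ∈ F, Disjoint (f • C) C) ∧ ∀ j k, j ≠ k → Disjoint (γ j • D) (γ k • D)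

/-- The Hilbert space `ℓ²(Γ)`. -/
abbrev EllTwo : Type _ := lp (fun _ : Γ => ℂ) 2

variable {Γ}

/-- The left regular representation: `(λ(g) ξ)(h) = ξ(g⁻¹ h)`. -/
noncomputable def leftRegular (g : Γ) : EllTwo Γ →L[ℂ] EllTwo Γ :=
  LinearIsometry.toContinuousLinearMap
    { toFun := fun ξ => ⟨fun h => ξ (g⁻¹ * h), by
        have hξ := lp.memℓp ξ
        rw [memℓp_gen_iff (by norm_num)] at hξ
        exact memℓp_gen ((Equiv.mulLeft g⁻¹).summable_iff.mpr hξ)⟩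
      map_add' := fun _ _ => rfl
      map_smul' := fun _ _ => rfl
      norm_map' := fun ξ => by
        rw [lp.norm_eq_tsum_rpow (by norm_num), lp.norm_eq_tsum_rpow (by norm_num)]
        congr 1
        exact (Equiv.mulLeft g⁻¹).tsum_eq (fun h => ‖ξ h‖ ^ (2 : ENNReal).toReal) }

theorem leftRegular_apply (g : Γ) (ξ : EllTwo Γ) (h : Γ) : leftRegular g ξ h = ξ (g⁻¹ * h) := rfl

variable (Γ)

/-- The reduced group C*-algebra `C*_r(Γ)`: the C*-subalgebra of `B(ℓ²(Γ))` generated by the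
operators `λ(g)`. -/
noncomputable def reducedCStarAlgebra : StarSubalgebra ℂ (EllTwo Γ →L[ℂ] EllTwo Γ) :=
  (StarAlgebra.adjoin ℂ (Set.range (leftRegular (Γ := Γ)))).topologicalClosure

/-- `Γ` is C*-simple if `C*_r(Γ)` has no non-trivial proper closed two-sided ideal. -/
def IsCStarSimple : Prop :=
  ∀ I : TwoSidedIdeal (reducedCStarAlgebra Γ),
    IsClosed (I : Set (reducedCStarAlgebra Γ)) → I = ⊥ ∨ I = ⊤

end CStar

end TreeAction

-- The hub of the equivalences is the pair of conditions on fixators of half-trees, and everything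
-- is expressed through shadows, which are exactly the half-trees (`isHalfTree_iff`). Minimality and
-- two transverse hyperbolic elements make the action so mobile that any half-tree can be carried
-- into any other (`exists_smul_shadow_subset`): an axis has a translate of one of its half-trees
-- inside every half-tree, and a transverse element exchanges the two sides of the axis up to powers
-- of the translation. Hence all fixators are trivial as soon as one is.
--
-- If both halves of an edge have non-trivial fixators, one non-trivial element from each gives a
-- pair such that every vertex and every end is fixed by one of the two; this contradicts strong
-- faithfulness. A non-trivial fixator of a single half-tree already fixes a non-empty open set of
-- ends, which contradicts slenderness.
--
-- Conversely, suppose fixators are trivial. The core is `exists_shadow_disjoint`: every half-tree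
-- contains a smaller one that a given g ≠ 1 moves off itself. Iterating over a finite set F yields
-- one half-tree Z with fZ ∩ Z = ∅ for all f in F. Its vertices and ends witness both forms of
-- strong faithfulness, and the version for one element gives slenderness.
--
-- The same Z gives the Powers property: pull Z and its complement back along an orbit map, and push
-- the complement into N disjoint half-trees. Powers' averaging then makes conjugates of a
-- normalised x*x, for x ≠ 0 in a closed ideal, average to operators close to 1, so the ideal
-- contains 1.

namespace TreeAction

open scoped Pointwise

/-! ### Distances and shadows in a tree -/

section TreeGeometry

variable {V : Type*} {T : SimpleGraph V}

theorem mem_shadow {a b v : V} : v ∈ shadow T a b ↔ T.dist v b < T.dist v a := Iff.rfl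

theorem not_mem_shadow_left (a b : V) : a ∉ shadow T a b := by
  simp [mem_shadow]

theorem mem_shadow_right {a b : V} (h : T.Adj a b) : b ∈ shadow T a b := by
  rw [mem_shadow, SimpleGraph.dist_self, SimpleGraph.dist_eq_one_iff_adj.2 h.symm]
  exact one_pos

theorem shadow_disjoint_reverse (a b : V) : Disjoint (shadow T a b) (shadow T b a) :=
  Set.disjoint_left.2 fun _ h h' => lt_asymm (mem_shadow.1 h) (mem_shadow.1 h')

theorem exists_adj_dist_add_one (hc : T.Connected) {v u : V} (h : v ≠ u) :
    ∃ w, T.Adj v w ∧ T.dist w u + 1 = T.dist v u := by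
  obtain ⟨p, hp⟩ := hc.exists_walk_length_eq_dist v u
  cases p with
  | nil => exact absurd rfl h
  | @cons _ w _ hw q =>
    refine ⟨w, hw, le_antisymm ?_ ?_⟩
    · rw [← hp, SimpleGraph.Walk.length_cons]
      exact Nat.add_le_add_right (T.dist_le q) 1
    · have := hc.dist_triangle (u := v) (v := w) (w := u)
      rw [SimpleGraph.dist_eq_one_iff_adj.2 hw] at this
      omega

theorem mem_shadow_of_dist_add_one {v w u : V} (h : T.dist w u + 1 = T.dist v u) :
    u ∈ shadow T v w := by
  rw [mem_shadow, T.dist_comm (u := u) (v := w), T.dist_comm (u := u) (v := v)]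
  omega

theorem exists_adj_mem_shadow (hc : T.Connected) {v u : V} (h : v ≠ u) :
    ∃ w, T.Adj v w ∧ u ∈ shadow T v w :=
  let ⟨w, hw, hd⟩ := exists_adj_dist_add_one hc h
  ⟨w, hw, mem_shadow_of_dist_add_one hd⟩

theorem shadow_dist (hT : T.IsTree) {a b v : V} (h : T.Adj a b) (hv : v ∈ shadow T a b) :
    T.dist v a = T.dist v b + 1 := by
  rcases hT.dist_eq_dist_add_one_of_adj v h with h1 | h1
  · exact h1
  · rw [mem_shadow] at hv
    omega

theorem not_mem_shadow_iff (hT : T.IsTree) {a b v : V} (h : T.Adj a b) :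
    v ∉ shadow T a b ↔ v ∈ shadow T b a := by
  rw [mem_shadow, mem_shadow, not_lt]
  exact ⟨fun hl => lt_of_le_of_ne hl (hT.dist_ne_of_adj v h), le_of_lt⟩

theorem mem_shadow_or (hT : T.IsTree) {a b : V} (h : T.Adj a b) (v : V) :
    v ∈ shadow T a b ∨ v ∈ shadow T b a := by
  rw [← not_mem_shadow_iff hT h]
  exact em _

theorem compl_shadow (hT : T.IsTree) {a b : V} (h : T.Adj a b) :
    (shadow T a b)ᶜ = shadow T b a :=
  Set.ext fun _ => not_mem_shadow_iff hT h

/-- A geodesic from v to b never leaves the shadow, and the deleted edge has its endpoint a outside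
the shadow, so the geodesic survives the deletion. -/
theorem reachable_deleteEdges_of_mem_shadow (hT : T.IsTree) {a b : V} :
    ∀ (n : ℕ) (v : V), T.dist v b = n → v ∈ shadow T a b →
      (T.deleteEdges {s(a, b)}).Reachable b v := by
  intro n
  induction n with
  | zero =>
    intro v hv _
    rw [hT.connected.dist_eq_zero_iff.1 hv]
  | succ n ih =>
    intro v hv hm
    have hne : v ≠ b := by
      rintro rfl
      simp at hv
    obtain ⟨w, hw, hd⟩ := exists_adj_dist_add_one hT.connected hne
    have hwm : w ∈ shadow T a b := by
      have := hT.connected.dist_triangle (u := v) (v := w) (w := a)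
      rw [SimpleGraph.dist_eq_one_iff_adj.2 hw] at this
      rw [mem_shadow] at hm ⊢
      omega
    refine (ih w (by omega) hwm).trans (SimpleGraph.Adj.reachable ?_)
    rw [SimpleGraph.deleteEdges_adj]
    refine ⟨hw.symm, fun he => ?_⟩
    have ha := not_mem_shadow_left (T := T) a b
    rcases Sym2.eq_iff.1 (Set.mem_singleton_iff.1 he) with ⟨h1, _⟩ | ⟨_, h2⟩
    · exact ha (h1 ▸ hwm)
    · exact ha (h2 ▸ hm)

/-- The only edge between the two sides of an edge is the edge itself. -/
theorem eq_of_adj_of_mem_shadow (hT : T.IsTree) {c d y z : V} (h : T.Adj c d) (hyz : T.Adj y z)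
    (hy : y ∈ shadow T d c) (hz : z ∈ shadow T c d) : y = c ∧ z = d := by
  by_contra hne
  have hb : T.IsBridge s(c, d) := SimpleGraph.isAcyclic_iff_forall_isBridge.1 hT.isAcyclic h
  rw [SimpleGraph.isBridge_iff] at hb
  have h1 := reachable_deleteEdges_of_mem_shadow hT _ y rfl hy
  have h2 := reachable_deleteEdges_of_mem_shadow hT _ z rfl hz
  rw [Sym2.eq_swap] at h1
  refine hb (h1.trans (SimpleGraph.Reachable.trans (SimpleGraph.Adj.reachable ?_) h2.symm))
  rw [SimpleGraph.deleteEdges_adj]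
  refine ⟨hyz, fun he => ?_⟩
  rcases Sym2.eq_iff.1 (Set.mem_singleton_iff.1 he) with ⟨h3, h4⟩ | ⟨h3, _⟩
  · exact hne ⟨h3, h4⟩
  · exact not_mem_shadow_left (T := T) d c (h3 ▸ hy)

/-- Geodesics between the two sides of an edge pass through the edge. -/
theorem dist_of_mem_shadow (hT : T.IsTree) {c d x u : V} (h : T.Adj c d)
    (hx : x ∈ shadow T d c) (hu : u ∈ shadow T c d) :
    T.dist x u = T.dist x c + 1 + T.dist d u := by
  have hcd := SimpleGraph.dist_eq_one_iff_adj.2 h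
  suffices H : ∀ (n : ℕ) (x : V), T.dist x u = n → x ∈ shadow T d c →
      T.dist x c + 1 + T.dist d u ≤ T.dist x u by
    refine le_antisymm ?_ (H _ x rfl hx)
    have h1 := hT.connected.dist_triangle (u := x) (v := c) (w := u)
    have h2 := hT.connected.dist_triangle (u := c) (v := d) (w := u)
    omega
  intro n
  induction n with
  | zero =>
    intro x hn hx
    rw [hT.connected.dist_eq_zero_iff.1 hn] at hx
    exact absurd hu (Set.disjoint_left.1 (shadow_disjoint_reverse _ _) hx)
  | succ n ih =>
    intro x hn hx
    have hne : x ≠ u := by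
      rintro rfl
      simp at hn
    obtain ⟨w, hw, hd⟩ := exists_adj_dist_add_one hT.connected hne
    rcases mem_shadow_or hT h w with hwm | hwm
    · obtain ⟨rfl, rfl⟩ := eq_of_adj_of_mem_shadow hT h hw hx hwm
      simp [← hd, add_comm]
    · have h1 := ih w (by omega) hwm
      have h2 := hT.connected.dist_triangle (u := x) (v := w) (w := c)
      rw [SimpleGraph.dist_eq_one_iff_adj.2 hw] at h2
      omega

theorem dist_add_of_mem_shadow (hT : T.IsTree) {c d x u : V} (h : T.Adj c d)
    (hx : x ∉ shadow T c d) (hu : u ∈ shadow T c d) :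
    T.dist x u = T.dist x c + T.dist c u := by
  have hcu := shadow_dist hT h hu
  rw [dist_of_mem_shadow hT h ((not_mem_shadow_iff hT h).1 hx) hu, T.dist_comm (u := c) (v := u),
    hcu, T.dist_comm (u := u) (v := d)]
  omega

theorem dist_add_of_mem_shadow' (hT : T.IsTree) {c d x u : V} (h : T.Adj c d)
    (hx : x ∉ shadow T c d) (hu : u ∈ shadow T c d) :
    T.dist x u = T.dist x d + T.dist d u := by
  have hx' := (not_mem_shadow_iff hT h).1 hx
  rw [dist_of_mem_shadow hT h hx' hu, shadow_dist hT h.symm hx']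

/-- Nestedness of shadows. -/
theorem shadow_subset_shadow (hT : T.IsTree) {a b c d : V} (h : T.Adj c d)
    (hd : d ∈ shadow T a b) (ha : a ∉ shadow T c d) : shadow T c d ⊆ shadow T a b := by
  intro u hu
  -- The geodesic from a to u passes through d, and b is closer to d than a is.
  have h1 := dist_add_of_mem_shadow' hT h ha hu
  have h2 := hT.connected.dist_triangle (u := b) (v := d) (w := u)
  rw [mem_shadow] at hd ⊢
  rw [T.dist_comm (u := u) (v := b), T.dist_comm (u := u) (v := a)]
  rw [T.dist_comm (u := d) (v := b), T.dist_comm (u := d) (v := a)] at hd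
  omega

/-- A geodesic from w' into the shadow behind w must go through v, so no point there is closer to w'
than to v. -/
theorem shadow_disjoint_of_ne (hT : T.IsTree) {v w w' : V} (h : T.Adj v w) (h' : T.Adj v w')
    (hne : w ≠ w') : Disjoint (shadow T v w) (shadow T v w') := by
  refine Set.disjoint_left.2 fun u hu hu' => ?_
  have hw' : w' ∉ shadow T v w := by
    have h1 : T.dist w' w ≠ 0 := fun h0 => hne (hT.connected.dist_eq_zero_iff.1 h0).symm
    rw [mem_shadow, SimpleGraph.dist_eq_one_iff_adj.2 h'.symm]
    omega
  have h1 := dist_add_of_mem_shadow hT h hw' hu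
  rw [SimpleGraph.dist_eq_one_iff_adj.2 h'.symm] at h1
  rw [mem_shadow, T.dist_comm (u := u) (v := v), T.dist_comm (u := u) (v := w')] at hu'
  omega

theorem shadow_subset_reverse (hT : T.IsTree) {v w w' : V} (h : T.Adj v w) (h' : T.Adj v w')
    (hne : w ≠ w') : shadow T v w ⊆ shadow T w' v := by
  intro u hu
  rw [← not_mem_shadow_iff hT h']
  exact Set.disjoint_left.1 (shadow_disjoint_of_ne hT h h' hne) hu

/-- Points on a geodesic are determined by their distance to an endpoint. -/
theorem eq_of_dist_eq (hT : T.IsTree) {p u a b : V} (ha : T.dist p a + T.dist a u = T.dist p u)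
    (hb : T.dist p b + T.dist b u = T.dist p u) (hab : T.dist p a = T.dist p b) : a = b := by
  by_contra hne
  obtain ⟨w, hw, hbw⟩ := exists_adj_mem_shadow hT.connected hne
  have hpos := hT.connected.pos_dist_of_ne hne
  -- Let w be the neighbour of a towards b. A point equidistant from a and b is closer to w than to
  -- a; applied to p and u this gives a path through w shorter than the geodesic.
  have key : ∀ x, T.dist x a = T.dist x b → x ∈ shadow T a w := by
    intro x hx
    by_contra hx'
    have := dist_add_of_mem_shadow hT hw hx' hbw
    omega
  have h1 := shadow_dist hT hw (key p hab)
  have h2 := shadow_dist hT hw (key u (by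
    rw [T.dist_comm (u := u) (v := a), T.dist_comm (u := u) (v := b)]; omega))
  have h3 := hT.connected.dist_triangle (u := p) (v := w) (w := u)
  rw [T.dist_comm (u := u) (v := a), T.dist_comm (u := u) (v := w)] at h2
  omega

/-- Every edge of a tree is a bridge, so the component of b cannot reach the other side. This lets
all later arguments use distances instead of components. -/
theorem isHalfTree_iff (hT : T.IsTree) {H : Set V} :
    IsHalfTree T H ↔ ∃ a b, T.Adj a b ∧ H = shadow T a b := by
  have key : ∀ a b, T.Adj a b →
      ((T.deleteEdges {s(a, b)}).connectedComponentMk b).supp = shadow T a b := by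
    intro a b h
    ext v
    rw [SimpleGraph.ConnectedComponent.mem_supp_iff, SimpleGraph.ConnectedComponent.eq]
    refine ⟨fun hr => ?_, fun hv => (reachable_deleteEdges_of_mem_shadow hT _ v rfl hv).symm⟩
    by_contra hv
    have h1 := reachable_deleteEdges_of_mem_shadow hT _ v rfl ((not_mem_shadow_iff hT h).1 hv)
    have hb : T.IsBridge s(a, b) := SimpleGraph.isAcyclic_iff_forall_isBridge.1 hT.isAcyclic h
    rw [SimpleGraph.isBridge_iff] at hb
    rw [Sym2.eq_swap] at h1
    exact hb (h1.trans hr)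
  constructor
  · rintro ⟨e, he, c, rfl⟩
    induction e with
    | h a b =>
      have h : T.Adj a b := he
      obtain ⟨v, rfl⟩ := c.exists_rep
      change ∃ a' b', T.Adj a' b' ∧
        ((T.deleteEdges {s(a, b)}).connectedComponentMk v).supp = shadow T a' b'
      rcases mem_shadow_or hT h v with hv | hv
      · refine ⟨a, b, h, ?_⟩
        rw [← key a b h, SimpleGraph.ConnectedComponent.eq.2
          (reachable_deleteEdges_of_mem_shadow hT _ v rfl hv)]
      · refine ⟨b, a, h.symm, ?_⟩
        rw [← key b a h.symm, Sym2.eq_swap, SimpleGraph.ConnectedComponent.eq.2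
          (reachable_deleteEdges_of_mem_shadow hT _ v rfl hv)]
  · rintro ⟨a, b, h, rfl⟩
    exact ⟨s(a, b), h, _, (key a b h).symm⟩

end TreeGeometry

-- Equivariance of shadows

section ShadowAction

variable {Γ : Type*} [Group Γ] {V : Type*} [MulAction Γ V] {T : SimpleGraph V} [ActsOnGraph Γ T]

theorem adj_smul_iff (g : Γ) {u v : V} : T.Adj (g • u) (g • v) ↔ T.Adj u v :=
  (toIso T g).map_adj_iff

theorem smul_mem_shadow_smul (g : Γ) {a b v : V} :
    g • v ∈ shadow T (g • a) (g • b) ↔ v ∈ shadow T a b := by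
  rw [mem_shadow, mem_shadow, dist_smul, dist_smul]

theorem smul_mem_shadow (g : Γ) {a b v : V} :
    g • v ∈ shadow T a b ↔ v ∈ shadow T (g⁻¹ • a) (g⁻¹ • b) := by
  rw [← smul_mem_shadow_smul g (a := g⁻¹ • a), smul_inv_smul, smul_inv_smul]

theorem smul_shadow (g : Γ) (a b : V) : g • shadow T a b = shadow T (g • a) (g • b) := by
  ext v
  rw [Set.mem_smul_set_iff_inv_smul_mem, smul_mem_shadow, inv_inv]

end ShadowAction

/-! ### Rays and lines -/

section Rays

variable {V : Type*} {T : SimpleGraph V}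

theorem dist_le_of_step (hc : T.Connected) {f : ℕ → V} (h : ∀ i, T.dist (f i) (f (i + 1)) ≤ 1)
    (i n : ℕ) : T.dist (f i) (f (i + n)) ≤ n := by
  induction n with
  | zero => simp
  | succ n ih =>
    have h1 := hc.dist_triangle (u := f i) (v := f (i + n)) (w := f (i + (n + 1)))
    have h2 := h (i + n)
    rw [← add_assoc] at h1 ⊢
    omega

/-- Slack in any segment would shorten every longer initial segment, so full length at arbitrarily
large times forces full length everywhere. -/
theorem isRay_of_step (hc : T.Connected) {f : ℕ → V} (h : ∀ i, T.dist (f i) (f (i + 1)) ≤ 1)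
    (hf : ∀ M, ∃ N, M ≤ N ∧ T.dist (f 0) (f N) = N) : IsRay T f := by
  intro i n
  obtain ⟨N, hN, hd⟩ := hf (i + n)
  obtain ⟨m, rfl⟩ := Nat.exists_eq_add_of_le hN
  have h1 := dist_le_of_step hc h 0 i
  have h2 := dist_le_of_step hc h i n
  have h3 := dist_le_of_step hc h (i + n) m
  have h4 := hc.dist_triangle (u := f 0) (v := f i) (w := f (i + n + m))
  have h5 := hc.dist_triangle (u := f i) (v := f (i + n)) (w := f (i + n + m))
  rw [zero_add] at h1
  omega

theorem dist_getVert_le_one {u v : V} (w : T.Walk u v) (i : ℕ) :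
    T.dist (w.getVert i) (w.getVert (i + 1)) ≤ 1 := by
  rcases lt_or_ge i w.length with h | h
  · exact (SimpleGraph.dist_eq_one_iff_adj.2 (w.adj_getVert_succ h)).le
  · rw [w.getVert_of_length_le h, w.getVert_of_length_le (by omega)]
    simp

variable (T) in
/-- A bi-infinite geodesic. -/
def IsLine (L : ℤ → V) : Prop :=
  ∀ (i : ℤ) (n : ℕ), T.dist (L i) (L (i + n)) = n

theorem isLine_of_step (hc : T.Connected) {L : ℤ → V} (h : ∀ i, T.dist (L i) (L (i + 1)) ≤ 1)
    (hL : ∀ M : ℕ, ∃ N : ℕ, M ≤ N ∧ T.dist (L (-N)) (L N) = 2 * N) : IsLine T L := by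
  intro i n
  obtain ⟨N, hN, hd⟩ := hL (i.natAbs + n)
  have hray : ∀ k m : ℕ, T.dist (L (-N + k)) (L (-N + (k + m : ℕ))) ≤ m :=
    dist_le_of_step hc (f := fun k : ℕ => L (-N + k)) (fun k => by
      have := h (-N + k)
      rwa [add_assoc] at this)
  obtain ⟨k, hk⟩ := Int.eq_ofNat_of_zero_le (a := i + N) (by omega)
  obtain ⟨m, hm⟩ := Int.eq_ofNat_of_zero_le (a := N - (i + n)) (by omega)
  have h1 := hray 0 k
  have h2 := hray k n
  have h3 := hray (k + n) m
  have e1 : -(N : ℤ) + (k : ℕ) = i := by omega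
  have e2 : -(N : ℤ) + (k + n : ℕ) = i + n := by push_cast; omega
  have e3 : -(N : ℤ) + (k + n + m : ℕ) = N := by push_cast; omega
  rw [zero_add, e1] at h1
  rw [e1, e2] at h2
  rw [e2, e3] at h3
  simp only [Nat.cast_zero, add_zero] at h1
  have h4 := hc.dist_triangle (u := L (-N)) (v := L i) (w := L N)
  have h5 := hc.dist_triangle (u := L i) (v := L (i + n)) (w := L N)
  omega

theorem IsLine.reverse {L : ℤ → V} (hL : IsLine T L) : IsLine T (fun n => L (-n)) := by
  intro i n
  have := hL (-(i + n)) n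
  rw [T.dist_comm]
  convert this using 3
  ring

theorem IsLine.isRay {L : ℤ → V} (hL : IsLine T L) (k : ℤ) :
    IsRay T (fun n : ℕ => L (k + n)) := by
  intro i n
  have := hL (k + i) n
  rwa [add_assoc, ← Nat.cast_add] at this

/-- The ray obtained from a line by following it from the origin in the positive direction. -/
def IsLine.ray {L : ℤ → V} (hL : IsLine T L) : Ray T :=
  ⟨fun n : ℕ => L n, by simpa using hL.isRay 0⟩

theorem IsLine.adj {L : ℤ → V} (hL : IsLine T L) (n : ℤ) : T.Adj (L n) (L (n + 1)) :=
  SimpleGraph.dist_eq_one_iff_adj.1 (by simpa using hL n 1)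

theorem IsLine.mem_shadow {L : ℤ → V} (hL : IsLine T L) {m n : ℤ} (h : n < m) :
    L m ∈ shadow T (L n) (L (n + 1)) := by
  obtain ⟨k, hk⟩ := Int.eq_ofNat_of_zero_le (a := m - (n + 1)) (by omega)
  have h1 := hL (n + 1) k
  have h2 := hL n (k + 1)
  rw [show n + 1 + (k : ℤ) = m by omega] at h1
  rw [show n + ((k + 1 : ℕ) : ℤ) = m by push_cast; omega] at h2
  rw [TreeAction.mem_shadow, T.dist_comm, h1, T.dist_comm, h2]
  omega

theorem IsLine.not_mem_shadow {L : ℤ → V} (hL : IsLine T L) {m n : ℤ} (h : m ≤ n) :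
    L m ∉ shadow T (L n) (L (n + 1)) := by
  obtain ⟨k, hk⟩ := Int.eq_ofNat_of_zero_le (a := n - m) (by omega)
  have h1 := hL m k
  have h2 := hL m (k + 1)
  rw [show m + (k : ℤ) = n by omega] at h1
  rw [show m + ((k + 1 : ℕ) : ℤ) = n + 1 by push_cast; omega] at h2
  rw [TreeAction.mem_shadow, h1, h2]
  omega

theorem Ray.adj (r : Ray T) (i : ℕ) : T.Adj (r.1 i) (r.1 (i + 1)) :=
  SimpleGraph.dist_eq_one_iff_adj.1 (by simpa using r.2 i 1)

theorem Ray.mem_shadow (r : Ray T) {i j : ℕ} (h : i < j) :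
    r.1 j ∈ shadow T (r.1 i) (r.1 (i + 1)) := by
  obtain ⟨k, rfl⟩ := Nat.exists_eq_add_of_lt h
  have h1 := r.2 (i + 1) k
  have h2 := r.2 i (k + 1)
  rw [show i + 1 + k = i + k + 1 by omega] at h1
  rw [← add_assoc] at h2
  rw [TreeAction.mem_shadow, T.dist_comm, h1, T.dist_comm, h2]
  omega

/-- Reaching this shadow from the start of the ray costs at least i + 1 steps. -/
theorem Ray.not_mem_shadow (hT : T.IsTree) (r : Ray T) {a : V} {i : ℕ}
    (h : T.dist a (r.1 0) ≤ i) : a ∉ shadow T (r.1 i) (r.1 (i + 1)) := by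
  intro ha
  have hr : r.1 0 ∉ shadow T (r.1 i) (r.1 (i + 1)) := by
    have h1 := r.2 0 i
    have h2 := r.2 0 (i + 1)
    rw [zero_add] at h1 h2
    rw [TreeAction.mem_shadow, h1, h2]
    omega
  have h1 := dist_of_mem_shadow hT (r.adj i) ((not_mem_shadow_iff hT (r.adj i)).1 hr) ha
  have h2 := r.2 0 i
  rw [zero_add] at h2
  rw [h2, T.dist_comm (u := r.1 0)] at h1
  omega

theorem Ray.shadow_anti (hT : T.IsTree) (r : Ray T) {m n : ℕ} (h : m ≤ n) :
    shadow T (r.1 n) (r.1 (n + 1)) ⊆ shadow T (r.1 m) (r.1 (m + 1)) := by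
  refine shadow_subset_shadow hT (r.adj n) (r.mem_shadow (by omega)) ?_
  obtain ⟨l, rfl⟩ := Nat.exists_eq_add_of_le h
  have h1 := r.2 m l
  have h2 := r.2 m (l + 1)
  rw [← add_assoc] at h2
  rw [TreeAction.mem_shadow, h1, h2]
  omega

/-- Two rays whose shadows always meet are cofinal. -/
theorem Ray.cofinal_of_not_disjoint (hT : T.IsTree) (r s : Ray T)
    (h : ∀ n, ¬ Disjoint (shadow T (r.1 n) (r.1 (n + 1))) (shadow T (s.1 n) (s.1 (n + 1)))) :
    ∃ k n : ℕ, ∀ i : ℕ, r.1 (i + k) = s.1 (i + n) := by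
  -- From time k on, the vertex s 0 lies behind r, so r recedes from it at unit speed. The two
  -- vertices compared then lie on one geodesic from s 0 to a common point u of two shadows, at the
  -- same distance from s 0.
  set k := T.dist (s.1 0) (r.1 0) with hk
  refine ⟨k, T.dist (s.1 0) (r.1 k), fun i => ?_⟩
  set j := i + T.dist (s.1 0) (r.1 k) with hj
  obtain ⟨u, hu, hu'⟩ := Set.not_disjoint_iff.1 (h (max (i + k) j))
  have hur := r.shadow_anti hT (le_max_left (i + k) j) hu
  have hus := s.shadow_anti hT (le_max_right (i + k) j) hu'
  have h1 := dist_add_of_mem_shadow hT (r.adj _) (r.not_mem_shadow hT (a := s.1 0) (by omega)) hur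
  have h2 := dist_add_of_mem_shadow hT (s.adj _)
    (s.not_mem_shadow hT (a := s.1 0) (i := j) (by simp)) hus
  have h3 : T.dist (s.1 0) (r.1 (i + k)) = T.dist (s.1 0) (r.1 k) + i := by
    rcases Nat.eq_zero_or_pos i with rfl | hi
    · simp
    · have h4 := dist_add_of_mem_shadow hT (r.adj k) (r.not_mem_shadow hT (a := s.1 0) hk.ge)
        (r.mem_shadow (i := k) (j := i + k) (by omega))
      have h5 := r.2 k i
      rw [add_comm k i] at h5
      rw [h4, h5]
  refine eq_of_dist_eq hT h1.symm h2.symm ?_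
  have h6 := s.2 0 j
  rw [zero_add] at h6
  rw [h3, h6]
  omega

/-- Every ray can be modified to start at a given vertex. -/
theorem Ray.exists_from (hT : T.IsTree) (r : Ray T) (a : V) {i : ℕ}
    (h : T.dist a (r.1 0) ≤ i) :
    ∃ t : Ray T, t.1 0 = a ∧ ∀ n, t.1 (n + T.dist a (r.1 i)) = r.1 (n + i) := by
  obtain ⟨w, hw⟩ := hT.connected.exists_walk_length_eq_dist a (r.1 i)
  set d := T.dist a (r.1 i) with hd
  -- Follow a geodesic from a to r i and then r. No backtracking occurs, since a lies outside the
  -- shadow of the edge that leaves r i.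
  let t : ℕ → V := fun m => if m < d then w.getVert m else r.1 (m - d + i)
  have ht : ∀ n, t (n + d) = r.1 (n + i) := fun n => by
    simp [t]
  have hlt : ∀ m, m ≤ d → t m = w.getVert m := fun m hm => by
    rcases hm.lt_or_eq with hm | rfl
    · simp [t, hm]
    · rw [← hw, w.getVert_length, hw]
      simpa using ht 0
  have hray : IsRay T t := by
    refine isRay_of_step hT.connected (fun m => ?_) (fun M => ⟨M + d, by omega, ?_⟩)
    · rcases lt_or_ge m d with hm | hm
      · rw [hlt m hm.le, hlt (m + 1) hm]
        exact dist_getVert_le_one w m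
      · obtain ⟨n, rfl⟩ := Nat.exists_eq_add_of_le' hm
        rw [ht, show n + d + 1 = n + 1 + d by omega, ht, show n + 1 + i = n + i + 1 by omega]
        exact (r.2 _ 1).le
    · rw [ht, hlt 0 (Nat.zero_le _), w.getVert_zero]
      rcases Nat.eq_zero_or_pos M with rfl | hM
      · simp [hd]
      · rw [dist_add_of_mem_shadow hT (r.adj i) (r.not_mem_shadow hT h)
          (r.mem_shadow (i := i) (j := M + i) (by omega)), add_comm M i, r.2 i M, ← hd, add_comm]
  exact ⟨⟨t, hray⟩, (hlt 0 (Nat.zero_le _)).trans w.getVert_zero, ht⟩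

/-- The boundary point represented by a ray. -/
def Ray.toBoundary (r : Ray T) : Boundary T :=
  Quotient.mk (raySetoid T) r

theorem Boundary.exists_ray (x : Boundary T) : ∃ r : Ray T, r.toBoundary = x :=
  Quotient.exists_rep x

theorem Ray.toBoundary_eq_iff {r s : Ray T} :
    r.toBoundary = s.toBoundary ↔ ∃ k n : ℕ, ∀ i : ℕ, r.1 (i + k) = s.1 (i + n) :=
  ⟨fun h => Quotient.exact h, fun h => Quotient.sound h⟩

/-- This replaces the existence of a representative crossing the edge by a tail condition on any
representative. For the converse the ray is rerouted to start at a; its first step must be to b,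
because distinct directions at a have disjoint shadows. -/
theorem mem_boundaryShadow_iff (hT : T.IsTree) {a b : V} (hab : T.Adj a b) (r : Ray T) :
    r.toBoundary ∈ boundaryShadow T a b ↔
      ∃ m, ∀ i, m ≤ i → r.1 i ∈ shadow T a b := by
  constructor
  · rintro ⟨s, ⟨j, rfl, rfl⟩, hs⟩
    obtain ⟨k, n, hkn⟩ := Ray.toBoundary_eq_iff.1 hs
    refine ⟨n + (j + 1), fun i hi => ?_⟩
    obtain ⟨l, rfl⟩ := Nat.exists_eq_add_of_le' (show n ≤ i by omega)
    rw [← hkn]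
    exact s.mem_shadow (by omega)
  · rintro ⟨m, hm⟩
    obtain ⟨t, ht0, ht⟩ := r.exists_from hT a (le_max_right m (T.dist a (r.1 0)))
    refine ⟨t, ⟨0, ht0, ?_⟩, Ray.toBoundary_eq_iff.2 ⟨_, _, ht⟩⟩
    by_contra hne
    have h0 := t.adj 0
    rw [zero_add, ht0] at h0
    have h1 := hm _ (show m ≤ 1 + max m (T.dist a (r.1 0)) by omega)
    have h2 := t.mem_shadow (i := 0) (j := 1 + T.dist a (r.1 (max m (T.dist a (r.1 0)))))
      (by omega)
    rw [← ht] at h1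
    rw [ht0] at h2
    exact Set.disjoint_left.1 (shadow_disjoint_of_ne hT hab h0 (Ne.symm hne)) h1 h2

theorem boundaryShadow_mono (hT : T.IsTree) {a b c d : V} (hab : T.Adj a b) (hcd : T.Adj c d)
    (h : shadow T c d ⊆ shadow T a b) : boundaryShadow T c d ⊆ boundaryShadow T a b := by
  intro x hx
  obtain ⟨r, rfl⟩ := x.exists_ray
  obtain ⟨m, hm⟩ := (mem_boundaryShadow_iff hT hcd r).1 hx
  exact (mem_boundaryShadow_iff hT hab r).2 ⟨m, fun i hi => h (hm i hi)⟩

theorem boundaryShadow_disjoint (hT : T.IsTree) {a b c d : V} (hab : T.Adj a b) (hcd : T.Adj c d)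
    (h : Disjoint (shadow T a b) (shadow T c d)) :
    Disjoint (boundaryShadow T a b) (boundaryShadow T c d) := by
  refine Set.disjoint_left.2 fun x hx hx' => ?_
  obtain ⟨r, rfl⟩ := x.exists_ray
  obtain ⟨m, hm⟩ := (mem_boundaryShadow_iff hT hab r).1 hx
  obtain ⟨n, hn⟩ := (mem_boundaryShadow_iff hT hcd r).1 hx'
  exact Set.disjoint_left.1 h (hm _ (le_max_left m n)) (hn _ (le_max_right m n))

theorem Ray.toBoundary_mem_boundaryShadow (r : Ray T) (n : ℕ) :
    r.toBoundary ∈ boundaryShadow T (r.1 n) (r.1 (n + 1)) :=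
  ⟨r, ⟨n, rfl, rfl⟩, rfl⟩

theorem mem_boundaryShadow_or (hT : T.IsTree) {a b : V} (hab : T.Adj a b) (x : Boundary T) :
    x ∈ boundaryShadow T a b ∨ x ∈ boundaryShadow T b a := by
  obtain ⟨r, rfl⟩ := x.exists_ray
  -- Far enough out, the shadow along r contains neither a nor b, so it nests in one side of the
  -- edge.
  set d := max (T.dist a (r.1 0)) (T.dist b (r.1 0)) with hd
  have ha : a ∉ shadow T (r.1 d) (r.1 (d + 1)) := r.not_mem_shadow hT (le_max_left _ _)
  have hb : b ∉ shadow T (r.1 d) (r.1 (d + 1)) := r.not_mem_shadow hT (le_max_right _ _)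
  refine (mem_shadow_or hT hab (r.1 (d + 1))).imp (fun h => ?_) fun h => ?_
  · exact boundaryShadow_mono hT hab (r.adj d) (shadow_subset_shadow hT (r.adj d) h ha)
      (r.toBoundary_mem_boundaryShadow d)
  · exact boundaryShadow_mono hT hab.symm (r.adj d) (shadow_subset_shadow hT (r.adj d) h hb)
      (r.toBoundary_mem_boundaryShadow d)

theorem preimage_extendedShadow (a b : V) :
    Boundary.toBordification T ⁻¹' extendedShadow T a b = boundaryShadow T a b := by
  ext x
  constructor
  · rintro (⟨v, _, hv⟩ | ⟨y, hy, hyx⟩)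
    · cases hv
    · cases hyx
      exact hy
  · exact fun hx => Or.inr ⟨x, hx, rfl⟩

/-- The boundary shadows along a ray form a neighbourhood base of its endpoint. -/
theorem Ray.exists_boundaryShadow_subset (hT : T.IsTree) (r : Ray T) {U : Set (Boundary T)}
    (hU : IsOpen U) (hr : r.toBoundary ∈ U) :
    ∃ n, boundaryShadow T (r.1 n) (r.1 (n + 1)) ⊆ U := by
  obtain ⟨W, hW, rfl⟩ := isOpen_induced_iff.1 hU
  -- Asking for all large m lets the induction on generated open sets pass through intersections.
  suffices H : ∃ n, ∀ m, n ≤ m → boundaryShadow T (r.1 m) (r.1 (m + 1)) ⊆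
      Boundary.toBordification T ⁻¹' W by
    obtain ⟨n, hn⟩ := H
    exact ⟨n, hn n le_rfl⟩
  clear hU
  induction hW with
  | basic W hW =>
    obtain ⟨a, b, hab, rfl⟩ := hW
    rw [preimage_extendedShadow] at hr ⊢
    obtain ⟨m, hm⟩ := (mem_boundaryShadow_iff hT hab r).1 hr
    refine ⟨max m (T.dist a (r.1 0)), fun n hn => ?_⟩
    exact boundaryShadow_mono hT hab (r.adj n) (shadow_subset_shadow hT (r.adj n)
      (hm _ (by omega)) (r.not_mem_shadow hT (by omega)))
  | univ => exact ⟨0, fun m _ x _ => trivial⟩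
  | inter s t _ _ ihs iht =>
    obtain ⟨n, hn⟩ := ihs hr.1
    obtain ⟨n', hn'⟩ := iht hr.2
    exact ⟨max n n', fun m hm x hx =>
      ⟨hn m ((le_max_left _ _).trans hm) hx, hn' m ((le_max_right _ _).trans hm) hx⟩⟩
  | sUnion S _ ih =>
    obtain ⟨s, hs, hrs⟩ := hr
    obtain ⟨n, hn⟩ := ih s hs hrs
    exact ⟨n, fun m hm x hx => ⟨s, hs, hn m hm hx⟩⟩

theorem isOpen_boundaryShadow {a b : V} (hab : T.Adj a b) : IsOpen (boundaryShadow T a b) := by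
  refine isOpen_induced_iff.2 ⟨extendedShadow T a b,
    TopologicalSpace.isOpen_generateFrom_of_mem ⟨a, b, hab, rfl⟩, preimage_extendedShadow a b⟩

end Rays

/-! ### Hyperbolic elements and half-trees -/

section HalfTrees

variable {Γ : Type*} [Group Γ] {V : Type*} [MulAction Γ V] {T : SimpleGraph V} [ActsOnGraph Γ T]

theorem Ray.smul_toBoundary (g : Γ) (r : Ray T) :
    g • r.toBoundary = (Ray.smul T g r).toBoundary := rfl

theorem smul_mem_boundaryShadow_smul (g : Γ) {a b : V} {x : Boundary T}
    (hx : x ∈ boundaryShadow T a b) : g • x ∈ boundaryShadow T (g • a) (g • b) := by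
  obtain ⟨r, ⟨j, rfl, rfl⟩, rfl⟩ := hx
  exact ⟨Ray.smul T g r, ⟨j, rfl, rfl⟩, rfl⟩

/-- At a vertex x of minimal displacement the segments [x, gx] and [gx, g²x] do not backtrack:
otherwise g reverses the first edge (displacement 1), or the next vertex has smaller displacement.
In a tree, local geodesics are geodesics, so lengths add. -/
theorem IsHyperbolic.exists_dist_pow (hT : T.IsTree) {g : Γ} (hg : IsHyperbolic T g) :
    ∃ (ℓ : ℕ) (x : V), 0 < ℓ ∧ ∀ n : ℕ, T.dist x (g ^ n • x) = n * ℓ := by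
  have := hT.connected.nonempty
  set x : V := Function.argmin (fun x : V => T.dist x (g • x)) with hx
  have hmin : ∀ y, T.dist x (g • x) ≤ T.dist y (g • y) := fun y =>
    Function.argmin_le (fun x : V => T.dist x (g • x)) y
  have hne : x ≠ g • x := fun h => hg.1 ⟨x, h.symm⟩
  obtain ⟨z, hxz, hz⟩ := exists_adj_mem_shadow hT.connected hne
  have hgz : T.Adj (g • x) (g • z) := ActsOnGraph.adj_smul g _ _ hxz
  have hpos := hT.connected.pos_dist_of_ne hne
  have hxz1 : T.dist z x = 1 := SimpleGraph.dist_eq_one_iff_adj.2 hxz.symm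
  have hloc : x ∉ shadow T (g • x) (g • z) := by
    intro hmem
    have h1 := shadow_dist hT hxz hz
    have h2 := shadow_dist hT hgz hmem
    rw [T.dist_comm, T.dist_comm (u := g • x)] at h1
    by_cases hl : T.dist x (g • x) = 1
    · have e1 : z = g • x := hT.connected.dist_eq_zero_iff.1 (by omega)
      have e2 : x = g • z := hT.connected.dist_eq_zero_iff.1 (by omega)
      exact hg.2 ⟨hg.1, x, z, hxz, e1.symm, e2.symm⟩
    · by_cases hzm : z ∈ shadow T (g • x) (g • z)
      · have h3 := shadow_dist hT hgz hzm
        have h4 := hmin z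
        omega
      · have h3 := dist_add_of_mem_shadow hT hgz hzm hmem
        rw [T.dist_comm (u := g • x)] at h3
        omega
  refine ⟨T.dist x (g • x), x, hpos, fun n => ?_⟩
  -- The induction must also remember that the next segment leaves in a direction away from x.
  suffices H : T.dist x (g ^ n • x) = n * T.dist x (g • x) ∧
      x ∉ shadow T (g ^ n • x) (g ^ n • z) from H.1
  have hadj : ∀ n : ℕ, T.Adj (g ^ n • x) (g ^ n • z) := fun n =>
    ActsOnGraph.adj_smul _ _ _ hxz
  induction n with
  | zero => simpa using not_mem_shadow_left x z
  | succ n ih =>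
    have h1 : g ^ (n + 1) • x ∈ shadow T (g ^ n • x) (g ^ n • z) := by
      rw [pow_succ, mul_smul, smul_mem_shadow_smul]
      exact hz
    have h2 : T.dist (g ^ n • x) (g ^ (n + 1) • x) = T.dist x (g • x) := by
      rw [pow_succ, mul_smul, dist_smul]
    have h3 := dist_add_of_mem_shadow hT (hadj n) ih.2 h1
    rw [ih.1, h2] at h3
    refine ⟨by rw [h3]; ring, fun hmem => ?_⟩
    have h4 : g ^ n • x ∉ shadow T (g ^ (n + 1) • x) (g ^ (n + 1) • z) := by
      rw [pow_succ, mul_smul, mul_smul, smul_mem_shadow_smul]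
      exact hloc
    have h5 := dist_add_of_mem_shadow hT (hadj (n + 1)) h4 hmem
    rw [T.dist_comm (v := x), ih.1, T.dist_comm (v := x), h3, h2] at h5
    omega

/-- A hyperbolic element translates along a bi-infinite geodesic. -/
theorem IsHyperbolic.exists_axis (hT : T.IsTree) {g : Γ} (hg : IsHyperbolic T g) :
    ∃ (ℓ : ℕ) (L : ℤ → V), 0 < ℓ ∧ IsLine T L ∧ ∀ n, g • L n = L (n + ℓ) := by
  obtain ⟨ℓ, x, hℓ, hx⟩ := hg.exists_dist_pow hT
  obtain ⟨w, hw⟩ := hT.connected.exists_walk_length_eq_dist x (g • x)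
  have hw' : w.length = ℓ := by
    have := hx 1
    rw [pow_one] at this
    omega
  have hℓ' : (ℓ : ℤ) ≠ 0 := by omega
  have hL0 : ∀ m : ℤ, g ^ (m * ℓ / ℓ) • w.getVert (m * ℓ % ℓ).toNat = g ^ m • x := fun m => by
    rw [Int.mul_ediv_cancel _ hℓ', Int.mul_emod_left]
    simp
  -- The axis concatenates the translates of the geodesic from x to gx: quotient and remainder by ℓ
  -- select the translate and the vertex on it.
  refine ⟨ℓ, fun k => g ^ (k / (ℓ : ℤ)) • w.getVert (k % (ℓ : ℤ)).toNat, hℓ,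
    isLine_of_step hT.connected (fun k => ?_) (fun M => ⟨M * ℓ, ?_, ?_⟩), fun k => ?_⟩
  · have hr0 := Int.emod_nonneg k hℓ'
    have hr1 := Int.emod_lt_of_pos k (show (0 : ℤ) < ℓ by omega)
    have hk := Int.mul_ediv_add_emod k ℓ
    have key : g ^ ((k + 1) / (ℓ : ℤ)) • w.getVert ((k + 1) % (ℓ : ℤ)).toNat =
        g ^ (k / (ℓ : ℤ)) • w.getVert ((k % (ℓ : ℤ)).toNat + 1) := by
      rcases (show k % ℓ + 1 < ℓ ∨ k % ℓ + 1 = ℓ by omega) with h | h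
      · obtain ⟨h1, h2⟩ := (Int.ediv_emod_unique (a := k + 1) (b := ℓ) (r := k % ℓ + 1)
          (q := k / ℓ) (by omega)).2 ⟨by linarith, by omega, h⟩
        rw [h1, h2, show (k % (ℓ : ℤ) + 1).toNat = (k % (ℓ : ℤ)).toNat + 1 by omega]
      · obtain ⟨h1, h2⟩ := (Int.ediv_emod_unique (a := k + 1) (b := ℓ) (r := 0)
          (q := k / ℓ + 1) (by omega)).2 ⟨by linarith, le_rfl, by omega⟩
        rw [h1, h2, show (k % (ℓ : ℤ)).toNat + 1 = w.length by omega, w.getVert_length,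
          zpow_add_one, mul_smul]
        simp
    rw [key, dist_smul]
    exact dist_getVert_le_one w _
  · exact Nat.le_mul_of_pos_right M hℓ
  · have h1 := hL0 (-M)
    have h2 := hL0 M
    rw [neg_mul] at h1
    push_cast
    rw [h1, h2, ← dist_smul T (g ^ (M : ℤ)), ← mul_smul, ← mul_smul, ← zpow_add, ← zpow_add]
    have h3 := hx (2 * M)
    rw [add_neg_cancel, zpow_zero, one_smul, ← Nat.cast_add, zpow_natCast, ← two_mul, h3]
    ring
  · have hk := Int.mul_ediv_add_emod k ℓ
    obtain ⟨h1, h2⟩ := (Int.ediv_emod_unique (a := k + ℓ) (b := ℓ) (r := k % ℓ)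
      (q := k / ℓ + 1) (by omega)).2
      ⟨by linarith, Int.emod_nonneg k hℓ', Int.emod_lt_of_pos k (by omega)⟩
    simp only [h1, h2]
    rw [← mul_smul, ← zpow_one_add, add_comm]

theorem smul_line_shadow {g : Γ} {ℓ : ℕ} {L : ℤ → V} (hg : ∀ n, g • L n = L (n + ℓ)) (k n : ℤ) :
    g ^ k • shadow T (L n) (L (n + 1)) = shadow T (L (n + k * ℓ)) (L (n + k * ℓ + 1)) := by
  have key : ∀ k n : ℤ, g ^ k • L n = L (n + k * ℓ) := by
    intro k
    induction k with
    | zero => simp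
    | succ k ih =>
      intro n
      rw [zpow_add_one, mul_smul, hg, ih]
      congr 1
      ring
    | pred k ih =>
      intro n
      have h1 : g⁻¹ • L n = L (n - ℓ) := by
        rw [inv_smul_eq_iff, hg, sub_add_cancel]
      rw [zpow_sub_one, mul_smul, h1, ih]
      congr 1
      ring
  rw [smul_shadow, key, key]
  congr 2
  ring

theorem axis_reverse {g : Γ} {ℓ : ℕ} {L : ℤ → V} (hg : ∀ n, g • L n = L (n + ℓ)) (n : ℤ) :
    g⁻¹ • L (-n) = L (-(n + ℓ)) := by
  rw [inv_smul_eq_iff, hg]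
  congr 1
  ring

/-- The endpoint of the axis of `g` is fixed by `g`. -/
theorem smul_axis_endpoint {g : Γ} {ℓ : ℕ} {L : ℤ → V} (hL : IsLine T L)
    (hg : ∀ n, g • L n = L (n + ℓ)) : g • hL.ray.toBoundary = hL.ray.toBoundary := by
  rw [Ray.smul_toBoundary]
  refine Ray.toBoundary_eq_iff.2 ⟨0, ℓ, fun i => ?_⟩
  change g • L ((i + 0 : ℕ) : ℤ) = L ((i + ℓ : ℕ) : ℤ)
  rw [hg]
  push_cast
  simp

theorem not_smul_eq_of_disjoint {g h : Γ}
    (hd : Disjoint (MulAction.fixedBy (Bordification T) g) (MulAction.fixedBy (Bordification T) h))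
    {x : Boundary T} (hx : g • x = x) : h • x ≠ x := fun hx' =>
  Set.disjoint_left.1 hd
    (show (Sum.inr x : Bordification T) ∈ MulAction.fixedBy (Bordification T) g from
      congrArg Sum.inr hx) (congrArg Sum.inr hx')

/-- In a minimal action every orbit meets every half-tree. -/
theorem IsMinimalTreeAction.exists_smul_mem_shadow (hT : T.IsTree)
    (hmin : IsMinimalTreeAction Γ T) (x : V) {a b : V} (hab : T.Adj a b) :
    ∃ γ : Γ, γ • x ∈ shadow T a b := by
  by_contra! hx
  -- S is invariant. It is also convex: a translated geodesic can enter the shadow only across the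
  -- edge from a to b, and then its endpoint lies in the shadow too.
  set S : Set V := {v | ∀ γ : Γ, γ • v ∉ shadow T a b} with hS
  have hconn : (T.induce S).Connected := by
    have hpre : ∀ (n : ℕ) (u v : S), T.dist u.1 v.1 = n → (T.induce S).Reachable u v := by
      intro n
      induction n with
      | zero =>
        intro u v h
        rw [Subtype.ext (hT.connected.dist_eq_zero_iff.1 h)]
      | succ n ih =>
        rintro ⟨u, hu⟩ ⟨v, hv⟩ h
        have hne : u ≠ v := by
          rintro rfl
          simp at h
        obtain ⟨w, hw, hd⟩ := exists_adj_dist_add_one hT.connected hne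
        have hwS : w ∈ S := by
          intro γ hγ
          obtain ⟨e1, e2⟩ := eq_of_adj_of_mem_shadow hT hab (ActsOnGraph.adj_smul γ _ _ hw)
            ((not_mem_shadow_iff hT hab).1 (hu γ)) hγ
          have h1 := mem_shadow_of_dist_add_one hd
          rw [← smul_mem_shadow_smul γ, e1, e2] at h1
          exact hv γ h1
        have hr := ih ⟨w, hwS⟩ ⟨v, hv⟩ (by simp only at h ⊢; omega)
        exact (SimpleGraph.Adj.reachable (SimpleGraph.comap_adj.2 hw)).trans hr
    have : Nonempty S := ⟨⟨x, hx⟩⟩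
    exact SimpleGraph.Connected.mk fun u v => hpre _ u v rfl
  have huniv := hmin S hconn fun g v hv γ => by
    rw [← mul_smul]
    exact hv _
  have hb : b ∈ S := huniv ▸ Set.mem_univ b
  exact hb 1 (by rw [one_smul]; exact mem_shadow_right hab)

variable (Γ) in
/-- Every half-tree contains a translate of a shadow at one of the two ends of a line. -/
theorem exists_smul_line_shadow_subset (hT : T.IsTree) (hmin : IsMinimalTreeAction Γ T) {L : ℤ → V}
    (hL : IsLine T L) {a b : V} (hab : T.Adj a b) :
    ∃ (γ : Γ) (n : ℤ), γ • shadow T (L n) (L (n + 1)) ⊆ shadow T a b ∨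
      γ • shadow T (L (n + 1)) (L n) ⊆ shadow T a b := by
  obtain ⟨γ, hγ⟩ := hmin.exists_smul_mem_shadow hT (L 0) hab
  rw [smul_mem_shadow] at hγ
  set c := γ⁻¹ • a with hc
  set d := γ⁻¹ • b with hd
  have hcd : T.Adj c d := ActsOnGraph.adj_smul _ _ _ hab
  have key : ∀ {L : ℤ → V} (hL : IsLine T L) (h0 : ∀ m : ℕ, L m ∈ shadow T c d),
      ∃ n : ℤ, shadow T (L n) (L (n + 1)) ⊆ shadow T c d := by
    intro L hL h0
    refine ⟨(T.dist c (L 0) : ℕ), shadow_subset_shadow hT (hL.adj _) ?_ ?_⟩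
    · exact_mod_cast h0 (T.dist c (L 0) + 1)
    · exact_mod_cast hL.ray.not_mem_shadow hT (a := c) (i := T.dist c (L 0)) le_rfl
  -- If the line left the half-tree in both directions it would pass through c on both sides of L 0,
  -- giving a shortcut.
  have hconv : (∀ m : ℕ, L m ∈ shadow T c d) ∨ ∀ m : ℕ, L (-m) ∈ shadow T c d := by
    by_contra! h
    obtain ⟨⟨m, hm⟩, k, hk⟩ := h
    have h1 := dist_of_mem_shadow hT hcd ((not_mem_shadow_iff hT hcd).1 hm) hγ
    have h2 := dist_of_mem_shadow hT hcd ((not_mem_shadow_iff hT hcd).1 hk) hγ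
    have h3 := hT.connected.dist_triangle (u := L (-k)) (v := c) (w := L m)
    have h4 := hL (-k) k
    have h5 := hL 0 m
    have h6 := hL (-k) (k + m)
    rw [neg_add_cancel] at h4
    rw [zero_add, T.dist_comm] at h5
    rw [show -(k : ℤ) + ((k + m : ℕ) : ℤ) = m by push_cast; ring] at h6
    rw [T.dist_comm (u := c)] at h3
    omega
  rcases hconv with h | h
  · obtain ⟨n, hn⟩ := key hL h
    refine ⟨γ, n, Or.inl ?_⟩
    rwa [Set.smul_set_subset_iff_subset_inv_smul_set, smul_shadow]
  · obtain ⟨n, hn⟩ := key hL.reverse h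
    refine ⟨γ, -(n + 1), Or.inr ?_⟩
    rw [Set.smul_set_subset_iff_subset_inv_smul_set, smul_shadow]
    convert hn using 3
    ring

theorem IsLine.shadow_anti (hT : T.IsTree) {L : ℤ → V} (hL : IsLine T L) {m n : ℤ} (h : m ≤ n) :
    shadow T (L n) (L (n + 1)) ⊆ shadow T (L m) (L (m + 1)) :=
  shadow_subset_shadow hT (hL.adj n) (hL.mem_shadow (by omega)) (hL.not_mem_shadow h)

theorem IsLine.compl_shadow (hT : T.IsTree) {L : ℤ → V} (hL : IsLine T L) (n : ℤ) :
    (shadow T (L n) (L (n + 1)))ᶜ = shadow T (L (n + 1)) (L n) :=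
  TreeAction.compl_shadow hT (hL.adj n)

/-- Some translate of a positive shadow of an axis is contained in a negative one, provided some
group element moves the endpoint. -/
theorem exists_smul_shadow_subset_reverse (hT : T.IsTree) {g h : Γ} {ℓ : ℕ} (hℓ : 0 < ℓ)
    {L : ℤ → V} (hL : IsLine T L) (hg : ∀ n, g • L n = L (n + ℓ))
    (hh : h • hL.ray.toBoundary ≠ hL.ray.toBoundary) (m n : ℤ) :
    ∃ γ : Γ, γ • shadow T (L m) (L (m + 1)) ⊆ shadow T (L (n + 1)) (L n) := by
  have hdisj : ∃ i : ℕ, Disjoint (h • shadow T (L i) (L (i + 1))) (shadow T (L i) (L (i + 1))) := by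
    by_contra! hcon
    refine hh (Ray.toBoundary_eq_iff.2
      (Ray.cofinal_of_not_disjoint hT (Ray.smul T h hL.ray) hL.ray fun i => ?_))
    have := hcon i
    rw [smul_shadow] at this
    exact_mod_cast this
  obtain ⟨i, hi⟩ := hdisj
  have hle : ∀ k : ℤ, k ≤ k.natAbs * (ℓ : ℤ) := fun k => by
    have : (k.natAbs : ℤ) * 1 ≤ k.natAbs * (ℓ : ℤ) := by gcongr; omega
    omega
  -- A power of g pushes the shadow beyond i, h throws it into the complement, and a negative power
  -- of g pushes that complement into the one at n. Since ℓ ≥ 1, the absolute values of the index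
  -- differences suffice as exponents.
  have h1 : g ^ ((i - m).natAbs : ℤ) • shadow T (L m) (L (m + 1)) ⊆ shadow T (L i) (L (i + 1)) := by
    rw [smul_line_shadow hg]
    exact hL.shadow_anti hT (by linarith [hle (i - m)])
  have h2 : h • shadow T (L i) (L (i + 1)) ⊆ (shadow T (L i) (L (i + 1)))ᶜ :=
    hi.subset_compl_right
  have h3 : g ^ (-((i - n).natAbs : ℤ)) • (shadow T (L i) (L (i + 1)))ᶜ ⊆
      (shadow T (L n) (L (n + 1)))ᶜ := by
    rw [Set.smul_set_compl, smul_line_shadow hg, Set.compl_subset_compl]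
    exact hL.shadow_anti hT (by linarith [hle (i - n)])
  rw [← hL.compl_shadow hT]
  refine ⟨g ^ (-((i - n).natAbs : ℤ)) * (h * g ^ ((i - m).natAbs : ℤ)), ?_⟩
  rw [mul_smul, mul_smul]
  exact (Set.smul_set_mono ((Set.smul_set_mono h1).trans h2)).trans h3

/-- Any half-tree can be moved into any other half-tree. -/
theorem exists_smul_shadow_subset (hT : T.IsTree) (hmin : IsMinimalTreeAction Γ T)
    (hhyp : IsStronglyHyperbolic Γ T) {a b c d : V} (hab : T.Adj a b) (hcd : T.Adj c d) :
    ∃ γ : Γ, γ • shadow T a b ⊆ shadow T c d := by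
  obtain ⟨g, h, hg, -, hdisj⟩ := hhyp
  obtain ⟨ℓ, L, hℓ, hL, hgL⟩ := hg.exists_axis hT
  have hpos := exists_smul_shadow_subset_reverse hT hℓ hL hgL
    (not_smul_eq_of_disjoint hdisj (smul_axis_endpoint hL hgL))
  have hneg : ∀ m n : ℤ, ∃ γ : Γ, γ • shadow T (L (m + 1)) (L m) ⊆
      shadow T (L n) (L (n + 1)) := by
    intro m n
    have hfix : g • hL.reverse.ray.toBoundary = hL.reverse.ray.toBoundary :=
      (inv_smul_eq_iff.1 (smul_axis_endpoint hL.reverse (axis_reverse hgL))).symm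
    obtain ⟨γ, hγ⟩ := exists_smul_shadow_subset_reverse hT hℓ hL.reverse (axis_reverse hgL)
      (not_smul_eq_of_disjoint hdisj hfix) (-(m + 1)) (-(n + 1))
    refine ⟨γ, ?_⟩
    convert hγ using 3 <;> ring_nf
  -- Positive and negative half-trees of the axis embed in each other, so whichever kind first lands
  -- in the target, both kinds do.
  have hinto : ∀ {c d : V}, T.Adj c d →
      (∃ γ : Γ, γ • shadow T (L 0) (L (0 + 1)) ⊆ shadow T c d) ∧
        ∃ γ : Γ, γ • shadow T (L (0 + 1)) (L 0) ⊆ shadow T c d := by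
    intro c d hcd
    obtain ⟨γ, n, hγ | hγ⟩ := exists_smul_line_shadow_subset Γ hT hmin hL hcd
    · obtain ⟨γ₁, h₁⟩ := hneg 0 n
      obtain ⟨γ₂, h₂⟩ := hpos 0 0
      refine ⟨⟨γ * (γ₁ * γ₂), ?_⟩, γ * γ₁, ?_⟩
      · rw [mul_smul, mul_smul]
        exact (Set.smul_set_mono ((Set.smul_set_mono h₂).trans h₁)).trans hγ
      · rw [mul_smul]
        exact (Set.smul_set_mono h₁).trans hγ
    · obtain ⟨γ₁, h₁⟩ := hpos 0 n
      obtain ⟨γ₂, h₂⟩ := hneg 0 0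
      refine ⟨⟨γ * γ₁, ?_⟩, γ * (γ₁ * γ₂), ?_⟩
      · rw [mul_smul]
        exact (Set.smul_set_mono h₁).trans hγ
      · rw [mul_smul, mul_smul]
        exact (Set.smul_set_mono ((Set.smul_set_mono h₂).trans h₁)).trans hγ
  -- Taking complements, a positive axis half-tree inside the opposite side of the source puts the
  -- source inside a translate of a negative one, which in turn embeds in the target.
  obtain ⟨γ₁, h₁⟩ := (hinto hab.symm).1
  obtain ⟨γ₂, h₂⟩ := (hinto hcd).2
  rw [← compl_shadow hT hab, Set.subset_compl_comm, ← Set.smul_set_compl,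
    hL.compl_shadow hT] at h₁
  refine ⟨γ₂ * γ₁⁻¹, ?_⟩
  rw [mul_smul]
  exact (Set.smul_set_mono (Set.smul_set_subset_iff_subset_inv_smul_set.2
    (by rwa [inv_inv]))).trans h₂

theorem IsLine.dist_eq {L : ℤ → V} (hL : IsLine T L) (i j : ℤ) :
    T.dist (L i) (L j) = (j - i).natAbs := by
  rcases le_total i j with h | h
  · have := hL i (j - i).natAbs
    rwa [show i + ((j - i).natAbs : ℤ) = j by omega] at this
  · have := hL j (j - i).natAbs
    rwa [show j + ((j - i).natAbs : ℤ) = i by omega, T.dist_comm] at this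

/-- A line is not covered by another one with different endpoints. -/
theorem IsLine.exists_not_mem_range (hT : T.IsTree) {L M : ℤ → V} (hL : IsLine T L)
    (hM : IsLine T M) (h₁ : hL.ray.toBoundary ≠ hM.ray.toBoundary)
    (h₂ : hL.reverse.ray.toBoundary ≠ hM.ray.toBoundary) : ∃ u, u ∉ Set.range L := by
  have key : ∀ r : Ray T, r.toBoundary ≠ hM.ray.toBoundary → ∃ n, ∀ m, n ≤ m →
      Disjoint (shadow T (r.1 m) (r.1 (m + 1)))
        (shadow T (hM.ray.1 m) (hM.ray.1 (m + 1))) := by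
    intro r hr
    by_contra! hcon
    refine hr (Ray.toBoundary_eq_iff.2 (Ray.cofinal_of_not_disjoint hT r hM.ray fun n hn => ?_))
    obtain ⟨m, hm, hm'⟩ := hcon n
    exact hm' (hn.mono (r.shadow_anti hT hm) (hM.ray.shadow_anti hT hm))
  obtain ⟨n₁, hn₁⟩ := key _ h₁
  obtain ⟨n₂, hn₂⟩ := key _ h₂
  set N := max n₁ n₂
  by_contra! hall
  -- If L were everything, the tail of M would lie in a segment of L of length 2N; the vertices of M
  -- at N + 1 and 3N + 2 are 2N + 1 apart.
  have hbd : ∀ k : ℕ, N < k → ∃ j : ℤ, L j = M k ∧ -(N : ℤ) ≤ j ∧ j ≤ N := by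
    intro k hk
    obtain ⟨j, hj⟩ := hall (M k)
    have hMk : M k ∈ shadow T (hM.ray.1 N) (hM.ray.1 (N + 1)) := hM.ray.mem_shadow hk
    refine ⟨j, hj, ?_, ?_⟩
    · by_contra! hlt
      obtain ⟨i, hi⟩ := Int.eq_ofNat_of_zero_le (a := -j) (by omega)
      refine Set.disjoint_left.1 (hn₂ N (le_max_right _ _))
        (hL.reverse.ray.mem_shadow (j := i) (by omega)) ?_
      change L (-(i : ℤ)) ∈ _
      rw [← hi, neg_neg, hj]
      exact hMk
    · by_contra! hlt
      obtain ⟨i, hi⟩ := Int.eq_ofNat_of_zero_le (a := j) (by omega)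
      refine Set.disjoint_left.1 (hn₁ N (le_max_left _ _))
        (hL.ray.mem_shadow (j := i) (by omega)) ?_
      change L (i : ℤ) ∈ _
      rw [← hi, hj]
      exact hMk
  obtain ⟨j, hj, hj1, hj2⟩ := hbd (N + 1) (by omega)
  obtain ⟨k, hk, hk1, hk2⟩ := hbd (3 * N + 2) (by omega)
  have e1 := hL.dist_eq j k
  rw [hj, hk, hM.dist_eq] at e1
  omega

/-- Every half-tree contains a branching vertex. -/
theorem exists_branch (hT : T.IsTree) (hmin : IsMinimalTreeAction Γ T)
    (hhyp : IsStronglyHyperbolic Γ T) {a b : V} (hab : T.Adj a b) :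
    ∃ v w w' : V, T.Adj v w ∧ T.Adj v w' ∧ w ≠ w' ∧ v ∈ shadow T a b ∧
      shadow T v w ⊆ shadow T a b ∧ shadow T v w' ⊆ shadow T a b := by
  obtain ⟨g, h, hg, hh, hdisj⟩ := id hhyp
  obtain ⟨ℓ, L, hℓ, hL, hgL⟩ := hg.exists_axis hT
  obtain ⟨ℓ', M, hℓ', hM, hhM⟩ := hh.exists_axis hT
  have hMfix := smul_axis_endpoint hM hhM
  have hLfix : g • hL.reverse.ray.toBoundary = hL.reverse.ray.toBoundary :=
    (inv_smul_eq_iff.1 (smul_axis_endpoint hL.reverse (axis_reverse hgL))).symm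
  obtain ⟨u, hu⟩ := hL.exists_not_mem_range hT hM
    (fun e => not_smul_eq_of_disjoint hdisj (smul_axis_endpoint hL hgL) (e ▸ hMfix))
    (fun e => not_smul_eq_of_disjoint hdisj hLfix (e ▸ hMfix))
  obtain ⟨p⟩ := hT.connected (L 0) u
  -- A path to a vertex off the axis leaves it at some L k, which therefore has three directions.
  -- The half-tree on the axis side of the exit edge contains the two axis directions and can be
  -- moved into the target.
  obtain ⟨⟨⟨v, w⟩, hvw⟩, -, ⟨k, rfl⟩, hw⟩ := p.exists_boundary_dart (Set.range L) ⟨0, rfl⟩ hu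
  simp only at hvw hw
  have hp := hL.adj k
  have hm : T.Adj (L k) (L (k - 1)) := by
    have := hL.adj (k - 1)
    rw [sub_add_cancel] at this
    exact this.symm
  have hpm : L (k + 1) ≠ L (k - 1) := fun e => by
    have := hL.dist_eq (k + 1) (k - 1)
    rw [e, SimpleGraph.dist_self] at this
    omega
  obtain ⟨γ, hγ⟩ := exists_smul_shadow_subset hT hmin hhyp hvw.symm hab
  have hsub : ∀ {w' : V}, T.Adj (L k) w' → w' ≠ w →
      shadow T (γ • L k) (γ • w') ⊆ shadow T a b := fun h1 h2 => by
    rw [← smul_shadow]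
    exact (Set.smul_set_mono (shadow_subset_reverse hT h1 hvw h2)).trans hγ
  exact ⟨γ • L k, γ • L (k + 1), γ • L (k - 1), ActsOnGraph.adj_smul _ _ _ hp,
    ActsOnGraph.adj_smul _ _ _ hm, (MulAction.injective γ).ne hpm,
    hγ (Set.smul_mem_smul_set (mem_shadow_right hvw.symm)),
    hsub hp fun e => hw ⟨_, e⟩, hsub hm fun e => hw ⟨_, e⟩⟩

/-- Every half-tree contains an end. -/
theorem boundaryShadow_nonempty (hT : T.IsTree) (hmin : IsMinimalTreeAction Γ T)
    (hhyp : IsStronglyHyperbolic Γ T) {a b : V} (hab : T.Adj a b) :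
    (boundaryShadow T a b).Nonempty := by
  obtain ⟨g, h, hg, -, -⟩ := id hhyp
  obtain ⟨ℓ, L, hℓ, hL, hgL⟩ := hg.exists_axis hT
  obtain ⟨γ, hγ⟩ := exists_smul_shadow_subset hT hmin hhyp (hL.adj 0) hab
  rw [smul_shadow] at hγ
  exact ⟨γ • hL.ray.toBoundary, boundaryShadow_mono hT hab (ActsOnGraph.adj_smul _ _ _ (hL.adj 0))
    hγ (smul_mem_boundaryShadow_smul γ ⟨hL.ray, ⟨0, rfl, rfl⟩, rfl⟩)⟩

end HalfTrees

/-! ### Displacing half-trees -/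

section Displacement

variable {Γ : Type*} [Group Γ] {V : Type*} [MulAction Γ V] {T : SimpleGraph V} [ActsOnGraph Γ T]

theorem exists_smul_ne_of_fixingSubgroup_eq_bot {H : Set V} (hH : fixingSubgroup Γ H = ⊥) {g : Γ}
    (hg : g ≠ 1) : ∃ v ∈ H, g • v ≠ v := by
  by_contra! h
  exact hg ((Subgroup.mem_bot).1 (hH ▸ (mem_fixingSubgroup_iff Γ).2 h))

/-- Take the half-tree at v pointing away from o. A point common to it and its image would have v
and gv on its geodesic from o, at equal distance from o. -/
theorem exists_shadow_disjoint_of_fixed (hT : T.IsTree) {g : Γ} {o w v : V} (ho : g • o = o)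
    (hv : v ∈ shadow T o w) (hgv : g • v ≠ v) :
    ∃ p q, T.Adj p q ∧ shadow T p q ⊆ shadow T o w ∧
      Disjoint (g • shadow T p q) (shadow T p q) := by
  have hne : v ≠ o := fun h => not_mem_shadow_left o w (h ▸ hv)
  obtain ⟨p, hp, hop⟩ := exists_adj_mem_shadow hT.connected hne
  have hop' : o ∉ shadow T p v := (not_mem_shadow_iff hT hp.symm).2 hop
  have hgo : o ∉ shadow T (g • p) (g • v) := by
    rw [← smul_mem_shadow_smul g, ho] at hop'
    exact hop'
  refine ⟨p, v, hp.symm, shadow_subset_shadow hT hp.symm hv hop', ?_⟩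
  rw [smul_shadow, Set.disjoint_left]
  intro u hu hu'
  refine hgv (eq_of_dist_eq hT
    (dist_add_of_mem_shadow' hT (adj_smul_iff g |>.2 hp.symm) hgo hu).symm
    (dist_add_of_mem_shadow' hT hp.symm hop' hu').symm ?_)
  conv_lhs => rw [← ho]
  exact dist_smul T g o v

/-- For a common point u, v would lie between gv and u and gv between v and u, which is impossible
for v ≠ gv. -/
theorem disjoint_smul_shadow (hT : T.IsTree) {g : Γ} {v w : V} (hvw : T.Adj v w) (hgv : g • v ≠ v)
    (h1 : g • v ∉ shadow T v w) (h2 : g⁻¹ • v ∉ shadow T v w) :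
    Disjoint (g • shadow T v w) (shadow T v w) := by
  rw [smul_shadow, Set.disjoint_left]
  intro u hu hu'
  have h3 : v ∉ shadow T (g • v) (g • w) := by
    rwa [← smul_mem_shadow_smul g, smul_inv_smul] at h2
  have e1 := dist_add_of_mem_shadow hT hvw h1 hu'
  have e2 := dist_add_of_mem_shadow hT (adj_smul_iff g |>.2 hvw) h3 hu
  have e3 := hT.connected.pos_dist_of_ne hgv
  omega

/-- Since v' separates v from g⁻¹v', its image gv' separates gv from v'; hence gv lies in the same
direction from v' as gv'. -/
theorem smul_mem_shadow_of_axis (hT : T.IsTree) {g : Γ} {v v' w w' : V} (hw : T.Adj v' w)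
    (hw' : T.Adj v' w') (hv : v ∉ shadow T v' w) (h1 : g⁻¹ • v' ∈ shadow T v' w)
    (h2 : g • v' ∈ shadow T v' w') (hne : g • v' ≠ v') : g • v ∈ shadow T v' w' := by
  by_contra h
  have e1 := dist_add_of_mem_shadow hT hw hv h1
  have e2 := dist_add_of_mem_shadow hT hw' h h2
  rw [← dist_smul T g, ← dist_smul T g v v', ← dist_smul T g v', smul_inv_smul] at e1
  have e3 := hT.connected.pos_dist_of_ne hne
  rw [T.dist_comm (u := v')] at e2
  omega

/-- If half-trees have trivial fixators, then every half-tree contains a half-tree that a given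
non-trivial element moves off itself. -/
theorem exists_shadow_disjoint (hT : T.IsTree) (hmin : IsMinimalTreeAction Γ T)
    (hhyp : IsStronglyHyperbolic Γ T)
    (hfix : ∀ a b, T.Adj a b → fixingSubgroup Γ (shadow T a b) = ⊥) {g : Γ} (hg : g ≠ 1) {a b : V}
    (hab : T.Adj a b) : ∃ p q, T.Adj p q ∧ shadow T p q ⊆ shadow T a b ∧
      Disjoint (g • shadow T p q) (shadow T p q) := by
  -- Two nested branchings, v' lying behind w₁. If g fixes v or v', a trivial fixator supplies a
  -- moved vertex and hence a displaced half-tree. Otherwise, absent a displaced half-tree, every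
  -- direction chosen at o ∈ {v, v'} must contain go or g⁻¹o.
  obtain ⟨v, w₁, w₂, hw₁, hw₂, hne, -, hs₁, hs₂⟩ := exists_branch hT hmin hhyp hab
  obtain ⟨v', w₁', w₂', hw₁', hw₂', hne', hv', hs₁', hs₂'⟩ := exists_branch hT hmin hhyp hw₁
  have hfixed : ∀ {o w : V}, T.Adj o w → shadow T o w ⊆ shadow T a b → g • o = o →
      ∃ p q, T.Adj p q ∧ shadow T p q ⊆ shadow T a b ∧
        Disjoint (g • shadow T p q) (shadow T p q) := by
    intro o w how hs ho
    obtain ⟨u, hu, hgu⟩ := exists_smul_ne_of_fixingSubgroup_eq_bot (hfix o w how) hg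
    obtain ⟨p, q, hpq, h1, h2⟩ := exists_shadow_disjoint_of_fixed hT ho hu hgu
    exact ⟨p, q, hpq, h1.trans hs, h2⟩
  by_cases hgv : g • v = v
  · exact hfixed hw₁ hs₁ hgv
  by_cases hgv' : g • v' = v'
  · exact hfixed hw₁' (hs₁'.trans hs₁) hgv'
  by_contra hcon
  have hmem : ∀ {o w : V}, T.Adj o w → shadow T o w ⊆ shadow T a b → g • o ≠ o →
      g • o ∈ shadow T o w ∨ g⁻¹ • o ∈ shadow T o w := by
    intro o w how hs ho
    by_contra! h
    exact hcon ⟨o, w, how, hs, disjoint_smul_shadow hT how ho h.1 h.2⟩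
  have hv₁ : v ∉ shadow T v' w₁' := fun h => not_mem_shadow_left v w₁ (hs₁' h)
  have hv₂ : v ∉ shadow T v' w₂' := fun h => not_mem_shadow_left v w₁ (hs₂' h)
  have hd := Set.disjoint_left.1 (shadow_disjoint_of_ne hT hw₁' hw₂' hne')
  have hgv'i : g⁻¹ • v' ≠ v' := fun h => hgv' (inv_smul_eq_iff.1 h).symm
  -- The two directions at v' take one of gv', g⁻¹v' each, and gv, g⁻¹v follow them. Both then lie
  -- behind w₁, leaving none for w₂.
  have hboth : g • v ∈ shadow T v w₁ ∧ g⁻¹ • v ∈ shadow T v w₁ := by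
    have hinv : ∀ {u : V}, g⁻¹⁻¹ • v' ∈ shadow T v' u ↔ g • v' ∈ shadow T v' u := by
      simp
    rcases hmem hw₁' (hs₁'.trans hs₁) hgv' with h1 | h1 <;>
      rcases hmem hw₂' (hs₂'.trans hs₁) hgv' with h2 | h2
    · exact absurd h2 (hd h1)
    · exact ⟨hs₁' (smul_mem_shadow_of_axis hT hw₂' hw₁' hv₂ h2 h1 hgv'),
        hs₂' (smul_mem_shadow_of_axis hT hw₁' hw₂' hv₁ (hinv.2 h1) h2 hgv'i)⟩
    · exact ⟨hs₂' (smul_mem_shadow_of_axis hT hw₁' hw₂' hv₁ h1 h2 hgv'),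
        hs₁' (smul_mem_shadow_of_axis hT hw₂' hw₁' hv₂ (hinv.2 h2) h1 hgv'i)⟩
    · exact absurd h2 (hd h1)
  have hd' := Set.disjoint_left.1 (shadow_disjoint_of_ne hT hw₁ hw₂ hne)
  rcases hmem hw₂ hs₂ hgv with h | h
  · exact hd' hboth.1 h
  · exact hd' hboth.2 h

/-- Displacement is inherited by smaller half-trees, so the elements of F can be treated one at a
time. -/
theorem exists_shadow_disjoint_finset (hT : T.IsTree) (hmin : IsMinimalTreeAction Γ T)
    (hhyp : IsStronglyHyperbolic Γ T)
    (hfix : ∀ a b, T.Adj a b → fixingSubgroup Γ (shadow T a b) = ⊥) (F : Finset Γ)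
    (hF : (1 : Γ) ∉ F) {a b : V} (hab : T.Adj a b) :
    ∃ p q, T.Adj p q ∧ shadow T p q ⊆ shadow T a b ∧
      ∀ f ∈ F, Disjoint (f • shadow T p q) (shadow T p q) := by
  classical
  induction F using Finset.induction_on with
  | empty => exact ⟨a, b, hab, subset_rfl, by simp⟩
  | insert g F _ ih =>
    rw [Finset.mem_insert, not_or] at hF
    obtain ⟨p, q, hpq, hs, hd⟩ := ih hF.2
    obtain ⟨p', q', hpq', hs', hd'⟩ :=
      exists_shadow_disjoint hT hmin hhyp hfix (Ne.symm hF.1) hpq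
    refine ⟨p', q', hpq', hs'.trans hs, fun f hf => ?_⟩
    rcases Finset.mem_insert.1 hf with rfl | hf
    · exact hd'
    · exact (hd f hf).mono (Set.smul_set_mono hs') hs'

/-- At each branching, keep one direction and recurse into the other. -/
theorem exists_pairwise_disjoint_shadows (hT : T.IsTree) (hmin : IsMinimalTreeAction Γ T)
    (hhyp : IsStronglyHyperbolic Γ T) (N : ℕ) : ∀ {a b : V}, T.Adj a b →
    ∃ c d : Fin N → V, (∀ i, T.Adj (c i) (d i)) ∧ (∀ i, shadow T (c i) (d i) ⊆ shadow T a b) ∧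
      ∀ i j, i ≠ j → Disjoint (shadow T (c i) (d i)) (shadow T (c j) (d j)) := by
  induction N with
  | zero =>
    exact fun _ => ⟨Fin.elim0, Fin.elim0, fun i => i.elim0, fun i => i.elim0, fun i => i.elim0⟩
  | succ N ih =>
    intro a b hab
    obtain ⟨v, w, w', hw, hw', hne, -, hs, hs'⟩ := exists_branch hT hmin hhyp hab
    obtain ⟨c, d, hcd, hsub, hdisj⟩ := ih hw'
    have hd := shadow_disjoint_of_ne hT hw hw' hne
    refine ⟨Fin.cons v c, Fin.cons w d, ?_, ?_, ?_⟩
    · exact Fin.cases hw hcd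
    · exact Fin.cases hs fun i => (hsub i).trans hs'
    · refine Fin.cases (Fin.cases (fun h => absurd rfl h) fun j _ => ?_) fun i =>
        Fin.cases (fun _ => ?_) fun j hij => ?_
      · exact hd.mono_right (hsub j)
      · exact (hd.mono_right (hsub i)).symm
      · exact hdisj i j fun h => hij (h ▸ rfl)

theorem IsStronglyHyperbolic.exists_adj (hT : T.IsTree) (hhyp : IsStronglyHyperbolic Γ T) :
    ∃ a b, T.Adj a b := by
  obtain ⟨g, h, hg, -, -⟩ := hhyp
  obtain ⟨ℓ, L, -, hL, -⟩ := hg.exists_axis hT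
  exact ⟨_, _, hL.adj 0⟩

theorem isPowersGroup_of_fixingSubgroup_eq_bot (hT : T.IsTree) (hmin : IsMinimalTreeAction Γ T)
    (hhyp : IsStronglyHyperbolic Γ T)
    (hfix : ∀ a b, T.Adj a b → fixingSubgroup Γ (shadow T a b) = ⊥) : IsPowersGroup Γ := by
  obtain ⟨a, b, hab⟩ := hhyp.exists_adj hT
  refine ⟨?_, fun F hF N _ => ?_⟩
  · obtain ⟨g, h, hg, -, -⟩ := hhyp
    exact ⟨g, 1, fun h => hg.1 ⟨a, by rw [h, one_smul]⟩⟩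
  · obtain ⟨p, q, hpq, -, hd⟩ := exists_shadow_disjoint_finset hT hmin hhyp hfix F hF hab
    obtain ⟨c, d, hcd, -, hdisj⟩ := exists_pairwise_disjoint_shadows hT hmin hhyp N hab
    choose γ hγ using fun i => exists_smul_shadow_subset hT hmin hhyp hpq.symm (hcd i)
    -- C and D are the preimages of the displaced half-tree and its complement under the orbit map x
    -- ↦ x • a.
    refine ⟨{x | x • a ∈ shadow T p q}, {x | x • a ∈ shadow T q p}, γ, ?_, ?_, ?_, ?_⟩
    · exact Set.eq_univ_of_forall fun x => mem_shadow_or hT hpq _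
    · exact Set.disjoint_left.2 fun x hx hx' =>
        Set.disjoint_left.1 (shadow_disjoint_reverse p q) hx hx'
    · refine fun f hf => Set.disjoint_left.2 ?_
      rintro _ ⟨x, hx, rfl⟩ hx'
      refine Set.disjoint_left.1 (hd f hf) (Set.smul_mem_smul_set hx) ?_
      rw [← mul_smul]
      exact hx'
    · refine fun j k hjk => Set.disjoint_left.2 ?_
      rintro _ ⟨x, hx, rfl⟩ ⟨y, hy, hxy⟩
      have h1 := hγ j (Set.smul_mem_smul_set hx)
      have h2 := hγ k (Set.smul_mem_smul_set hy)
      rw [← mul_smul] at h1 h2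
      rw [show γ k * y = γ j * x from hxy] at h2
      exact Set.disjoint_left.1 (hdisj j k hjk) h1 h2

theorem fixingSubgroup_le_of_smul_subset {H K : Set V} {γ : Γ} (h : γ • H ⊆ K)
    (hH : fixingSubgroup Γ H = ⊥) : fixingSubgroup Γ K = ⊥ := by
  rw [eq_bot_iff]
  intro g hg
  rw [mem_fixingSubgroup_iff] at hg
  have h1 : γ⁻¹ * g * γ ∈ fixingSubgroup Γ H := by
    rw [mem_fixingSubgroup_iff]
    intro v hv
    rw [mul_smul, mul_smul, hg _ (h (Set.smul_mem_smul_set hv)), inv_smul_smul]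
  rw [hH, Subgroup.mem_bot, mul_assoc, inv_mul_eq_one] at h1
  exact Subgroup.mem_bot.2 (mul_eq_right.1 h1.symm)

theorem smul_eq_of_fixes_shadow (hT : T.IsTree) {g : Γ} {a b : V} (hab : T.Adj a b)
    (hg : g ∈ fixingSubgroup Γ (shadow T a b)) {x : Boundary T} (hx : x ∈ boundaryShadow T a b) :
    g • x = x := by
  obtain ⟨r, rfl⟩ := x.exists_ray
  obtain ⟨m, hm⟩ := (mem_boundaryShadow_iff hT hab r).1 hx
  rw [Ray.smul_toBoundary]
  exact Ray.toBoundary_eq_iff.2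
    ⟨m, m, fun i => (mem_fixingSubgroup_iff Γ).1 hg _ (hm _ (Nat.le_add_left m i))⟩

/-- Non-trivial elements of the two fixators would form a pair that no point of X escapes. The
general X serves both vertices and ends. -/
theorem fixingSubgroup_eq_bot_of_isStronglyFaithful {X : Type*} [MulAction Γ X]
    (hX : IsStronglyFaithful Γ X) {H K : Set V} {A B : Set X} (hAB : ∀ x, x ∈ A ∨ x ∈ B)
    (hA : ∀ g ∈ fixingSubgroup Γ H, ∀ x ∈ A, g • x = x)
    (hB : ∀ g ∈ fixingSubgroup Γ K, ∀ x ∈ B, g • x = x) :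
    fixingSubgroup Γ H = ⊥ ∨ fixingSubgroup Γ K = ⊥ := by
  classical
  by_contra! h
  obtain ⟨g, hg, hg1⟩ := (Subgroup.bot_or_exists_ne_one _).resolve_left h.1
  obtain ⟨k, hk, hk1⟩ := (Subgroup.bot_or_exists_ne_one _).resolve_left h.2
  obtain ⟨x, hx⟩ := hX {g, k} (by simp [hg1.symm, hk1.symm])
  rcases hAB x with h1 | h1
  · exact hx g (by simp) (hA g hg x h1)
  · exact hx k (by simp) (hB k hk x h1)

variable (T) in
theorem isTopologicallyFree_iff_isSlender :
    IsTopologicallyFree Γ (Boundary T) ↔ IsSlender Γ T := by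
  unfold IsTopologicallyFree interiorSubgroup IsSlender
  rw [Subgroup.closure_eq_bot_iff]
  refine ⟨fun h g hg => ?_, fun h g hg => ?_⟩
  · by_contra hne
    exact hg (h (Set.nonempty_iff_ne_empty.2 hne))
  · by_contra hne
    exact hg.ne_empty (h g hne)

theorem tfae_boundary_action (hT : T.IsTree) (hmin : IsMinimalTreeAction Γ T)
    (hhyp : IsStronglyHyperbolic Γ T) :
    List.TFAE
      [ interiorSubgroup Γ (Boundary T) = ⊥,
        IsStronglyFaithful Γ V,
        IsStronglyFaithful Γ (Boundary T),
        IsTopologicallyFree Γ (Boundary T),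
        IsSlender Γ T,
        ∀ H : Set V, IsHalfTree T H → fixingSubgroup Γ H = ⊥,
        ∃ H : Set V, IsHalfTree T H ∧ fixingSubgroup Γ H = ⊥ ] := by
  obtain ⟨a, b, hab⟩ := hhyp.exists_adj hT
  have hadj : (∀ H : Set V, IsHalfTree T H → fixingSubgroup Γ H = ⊥) →
      ∀ a b, T.Adj a b → fixingSubgroup Γ (shadow T a b) = ⊥ := fun h a b hab =>
    h _ ((isHalfTree_iff hT).2 ⟨a, b, hab, rfl⟩)
  have hsome : fixingSubgroup Γ (shadow T a b) = ⊥ ∨ fixingSubgroup Γ (shadow T b a) = ⊥ →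
      ∃ H : Set V, IsHalfTree T H ∧ fixingSubgroup Γ H = ⊥ := by
    rintro (h | h)
    · exact ⟨_, (isHalfTree_iff hT).2 ⟨a, b, hab, rfl⟩, h⟩
    · exact ⟨_, (isHalfTree_iff hT).2 ⟨b, a, hab.symm, rfl⟩, h⟩
  tfae_have 1 ↔ 4 := Iff.rfl
  tfae_have 4 ↔ 5 := isTopologicallyFree_iff_isSlender T
  tfae_have 7 → 6 := by
    rintro ⟨H, hH, hbot⟩ K hK
    obtain ⟨a, b, hab, rfl⟩ := (isHalfTree_iff hT).1 hH
    obtain ⟨c, d, hcd, rfl⟩ := (isHalfTree_iff hT).1 hK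
    obtain ⟨γ, hγ⟩ := exists_smul_shadow_subset hT hmin hhyp hab hcd
    exact fixingSubgroup_le_of_smul_subset hγ hbot
  tfae_have 2 → 7 := fun h => hsome
    (fixingSubgroup_eq_bot_of_isStronglyFaithful h (mem_shadow_or hT hab)
      (fun g hg => (mem_fixingSubgroup_iff Γ).1 hg) fun g hg => (mem_fixingSubgroup_iff Γ).1 hg)
  tfae_have 3 → 7 := fun h => hsome
    (fixingSubgroup_eq_bot_of_isStronglyFaithful h (mem_boundaryShadow_or hT hab)
      (fun g hg x hx => smul_eq_of_fixes_shadow hT hab hg hx)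
      fun g hg x hx => smul_eq_of_fixes_shadow hT hab.symm hg hx)
  tfae_have 6 → 2 := by
    intro h F hF
    obtain ⟨p, q, hpq, -, hd⟩ :=
      exists_shadow_disjoint_finset hT hmin hhyp (hadj h) F hF hab
    refine ⟨q, fun f hf e => ?_⟩
    refine Set.disjoint_left.1 (hd f hf) (Set.smul_mem_smul_set (mem_shadow_right hpq)) ?_
    rw [e]
    exact mem_shadow_right hpq
  have hbd : ∀ {f : Γ} {p q : V} {x : Boundary T}, T.Adj p q → x ∈ boundaryShadow T p q →
      Disjoint (f • shadow T p q) (shadow T p q) → f • x ≠ x := by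
    intro f p q x hpq hx hd e
    rw [smul_shadow] at hd
    refine Set.disjoint_left.1 (boundaryShadow_disjoint hT ((adj_smul_iff f).2 hpq) hpq hd)
      (smul_mem_boundaryShadow_smul f hx) ?_
    rw [e]
    exact hx
  tfae_have 6 → 3 := by
    intro h F hF
    obtain ⟨p, q, hpq, -, hd⟩ :=
      exists_shadow_disjoint_finset hT hmin hhyp (hadj h) F hF hab
    obtain ⟨x, hx⟩ := boundaryShadow_nonempty hT hmin hhyp hpq
    exact ⟨x, fun f hf => hbd hpq hx (hd f hf)⟩
  tfae_have 5 → 7 := by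
    refine fun h => hsome (Or.inl (eq_bot_iff.2 fun g hg => ?_))
    by_contra hg1
    obtain ⟨x, hx⟩ := boundaryShadow_nonempty hT hmin hhyp hab
    refine (h g hg1).le (interior_maximal ?_ (isOpen_boundaryShadow hab) hx)
    exact fun y hy => smul_eq_of_fixes_shadow hT hab hg hy
  tfae_have 6 → 5 := by
    intro h g hg
    by_contra hne
    obtain ⟨x, hx⟩ := Set.nonempty_iff_ne_empty.2 hne
    obtain ⟨r, rfl⟩ := x.exists_ray
    obtain ⟨n, hn⟩ := r.exists_boundaryShadow_subset hT isOpen_interior hx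
    -- Any open set of ends fixed by g would contain the ends of a half-tree displaced by g.
    obtain ⟨p, q, hpq, hs, hd⟩ := exists_shadow_disjoint hT hmin hhyp (hadj h) hg (r.adj n)
    obtain ⟨y, hy⟩ := boundaryShadow_nonempty hT hmin hhyp hpq
    exact hbd hpq hy hd
      (show y ∈ MulAction.fixedBy (Boundary T) g from
        interior_subset (hn (boundaryShadow_mono hT (r.adj n) hpq hs hy)))
  tfae_finish

end Displacement

/-! ### Powers groups are C*-simple -/

section PowersAveraging

/-- Powers' estimate: operators that are off-diagonal with respect to complements of
mutually orthogonal pieces have a small sum. -/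
theorem norm_sum_le_of_offDiagonal {E : Type*} [NormedAddCommGroup E] [InnerProductSpace ℂ E]
    {N : ℕ} (x : Fin N → E →L[ℂ] E) (p q : Fin N → E → E) {M : ℝ} (hx : ∀ j, ‖x j‖ ≤ M)
    (hpq : ∀ j v, p j v + q j v = v) (hq : ∀ j v, ‖q j v‖ ≤ ‖v‖)
    (hp : ∀ v, ∑ j, ‖p j v‖ ^ 2 ≤ ‖v‖ ^ 2)
    (h0 : ∀ j v w, inner ℂ (x j (q j v)) (q j w) = 0) (hM : 0 ≤ M) :
    ‖∑ j, x j‖ ≤ 2 * (√N * M) := by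
  refine ContinuousLinearMap.opNorm_le_bound _ (by positivity) fun v => ?_
  -- Cauchy–Schwarz over j: this is the source of √N in place of the trivial N.
  have hsum : ∀ v, ∑ j, ‖p j v‖ ≤ √N * ‖v‖ := fun v => by
    refine abs_le_of_sq_le_sq' ?_ (by positivity) |>.2
    rw [mul_pow, Real.sq_sqrt (Nat.cast_nonneg N)]
    refine sq_sum_le_card_mul_sum_sq.trans ?_
    rw [Finset.card_univ, Fintype.card_fin]
    gcongr
    exact hp v
  set w := (∑ j, x j) v with hw
  have key : ∀ j, ‖inner ℂ (x j v) w‖ ≤ M * ‖v‖ * ‖p j w‖ + M * ‖p j v‖ * ‖w‖ := by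
    intro j
    have hxv : ∀ u, ‖x j u‖ ≤ M * ‖u‖ := fun u => (x j).le_of_opNorm_le (hx j) u
    -- The q–q block vanishes, so each remaining term carries a summable factor p.
    have e : inner ℂ (x j v) w = inner ℂ (x j v) (p j w) + inner ℂ (x j (p j v)) (q j w) := by
      conv_lhs => rw [← hpq j w, inner_add_right]
      congr 1
      conv_lhs => rw [← hpq j v, map_add, inner_add_left, h0, add_zero]
    rw [e]
    refine (norm_add_le _ _).trans (add_le_add ?_ ?_)
    · exact (norm_inner_le_norm _ _).trans (by gcongr; exact hxv v)
    · refine (norm_inner_le_norm _ _).trans ?_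
      gcongr
      · exact hxv _
      · exact hq j w
  have h1 : ‖w‖ * ‖w‖ ≤ (2 * (√N * M) * ‖v‖) * ‖w‖ := by
    calc ‖w‖ * ‖w‖ = ‖inner ℂ w w‖ := by
          rw [inner_self_eq_norm_sq_to_K]
          simp [sq]
      _ = ‖∑ j, inner ℂ (x j v) w‖ := by
        rw [← sum_inner, hw, _root_.sum_apply]
      _ ≤ ∑ j, (M * ‖v‖ * ‖p j w‖ + M * ‖p j v‖ * ‖w‖) :=
        (norm_sum_le _ _).trans (Finset.sum_le_sum fun j _ => key j)
      _ = M * ‖v‖ * ∑ j, ‖p j w‖ + M * (∑ j, ‖p j v‖) * ‖w‖ := by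
        rw [Finset.sum_add_distrib, Finset.mul_sum, Finset.mul_sum, Finset.sum_mul]
      _ ≤ M * ‖v‖ * (√N * ‖w‖) + M * (√N * ‖v‖) * ‖w‖ := by
        gcongr
        · exact hsum w
        · exact hsum v
      _ = (2 * (√N * M) * ‖v‖) * ‖w‖ := by ring
  rcases (norm_nonneg w).eq_or_lt with h | h
  · rw [← h]
    positivity
  · exact le_of_mul_le_mul_right h1 h

end PowersAveraging

-- Restrictions and basis vectors in ℓ²(Γ)

section EllTwo

variable {Γ : Type*}

theorem EllTwo.summable (v : EllTwo Γ) : Summable fun g => ‖v g‖ ^ 2 := by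
  have := (lp.hasSum_norm (p := 2) (by norm_num) v).summable
  simpa using this

theorem EllTwo.norm_sq (v : EllTwo Γ) : ‖v‖ ^ 2 = ∑' g, ‖v g‖ ^ 2 := by
  have := lp.norm_rpow_eq_tsum (p := 2) (by norm_num) v
  simpa using this

open Classical in
/-- The restriction of a vector in `ℓ²(Γ)` to a subset of `Γ`. -/
noncomputable def EllTwo.restrict (S : Set Γ) (v : EllTwo Γ) : EllTwo Γ :=
  ⟨S.indicator v, by
    refine memℓp_gen ?_
    have h := v.summable
    simp only [ENNReal.toReal_ofNat, Real.rpow_two]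
    refine h.of_nonneg_of_le (fun g => by positivity) fun g => ?_
    gcongr
    exact norm_indicator_le_norm_self _ _⟩

theorem EllTwo.restrict_apply (S : Set Γ) (v : EllTwo Γ) (g : Γ) :
    EllTwo.restrict S v g = S.indicator v g := rfl

theorem EllTwo.norm_restrict_sq (S : Set Γ) (v : EllTwo Γ) :
    ‖EllTwo.restrict S v‖ ^ 2 = ∑' g, S.indicator (fun g => ‖v g‖ ^ 2) g := by
  rw [EllTwo.norm_sq]
  congr 1
  ext g
  by_cases h : g ∈ S <;> simp [EllTwo.restrict_apply, h]

theorem EllTwo.norm_restrict_le (S : Set Γ) (v : EllTwo Γ) : ‖EllTwo.restrict S v‖ ≤ ‖v‖ := by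
  refine (sq_le_sq₀ (norm_nonneg _) (norm_nonneg _)).1 ?_
  rw [EllTwo.norm_restrict_sq, EllTwo.norm_sq v]
  refine (v.summable.indicator S).tsum_le_tsum (fun g => ?_) v.summable
  exact Set.indicator_le_self' (fun _ _ => by positivity) g

theorem EllTwo.sum_norm_restrict_sq_le {N : ℕ} (S : Fin N → Set Γ)
    (hS : ∀ i j, i ≠ j → Disjoint (S i) (S j)) (v : EllTwo Γ) :
    ∑ j, ‖EllTwo.restrict (S j) v‖ ^ 2 ≤ ‖v‖ ^ 2 := by
  simp only [EllTwo.norm_restrict_sq]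
  rw [← Summable.tsum_finsetSum fun j _ => v.summable.indicator (S j), EllTwo.norm_sq v]
  refine (summable_sum fun j _ => v.summable.indicator (S j)).tsum_le_tsum (fun g => ?_) v.summable
  by_cases h : ∃ j, g ∈ S j
  · obtain ⟨j, hj⟩ := h
    rw [Finset.sum_eq_single j, Set.indicator_of_mem hj]
    · exact fun i _ hij => Set.indicator_of_notMem
        (fun hi => Set.disjoint_left.1 (hS i j hij) hi hj) _
    · simp
  · push Not at h
    rw [Finset.sum_eq_zero fun j _ => Set.indicator_of_notMem (h j) _]
    positivity

theorem EllTwo.restrict_add_restrict {C D : Set Γ} (h : C ∪ D = Set.univ) (hCD : Disjoint C D)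
    (v : EllTwo Γ) : EllTwo.restrict D v + EllTwo.restrict C v = v := by
  refine lp.ext (funext fun g => ?_)
  rw [lp.coeFn_add, Pi.add_apply, EllTwo.restrict_apply, EllTwo.restrict_apply]
  rcases (h ▸ Set.mem_univ g : g ∈ C ∪ D) with hg | hg
  · rw [Set.indicator_of_mem hg, Set.indicator_of_notMem (Set.disjoint_left.1 hCD hg), zero_add]
  · rw [Set.indicator_of_mem hg, Set.indicator_of_notMem (Set.disjoint_right.1 hCD hg), add_zero]

open Classical in
/-- The canonical basis vectors of `ℓ²(Γ)`. -/
noncomputable def EllTwo.delta (g : Γ) : EllTwo Γ := lp.single 2 g 1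

theorem EllTwo.delta_apply (g h : Γ) [Decidable (h = g)] :
    EllTwo.delta g h = if h = g then 1 else 0 := by
  classical
  rw [EllTwo.delta, lp.single_apply, Pi.single_apply]
  congr

theorem EllTwo.norm_delta (g : Γ) : ‖EllTwo.delta g‖ = 1 := by
  classical
  rw [EllTwo.delta, lp.norm_single (by norm_num), norm_one]

end EllTwo

-- The reduced C*-algebra, its trace and averaging

section Regular

variable {Γ : Type*} [Group Γ]

theorem inner_leftRegular_restrict {g : Γ} {S : Set Γ} (h : Disjoint (g • S) S) (v w : EllTwo Γ) :
    inner ℂ (leftRegular g (EllTwo.restrict S v)) (EllTwo.restrict S w) = 0 := by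
  rw [lp.inner_eq_tsum]
  refine (tsum_congr fun k => ?_).trans tsum_zero
  rw [leftRegular_apply, EllTwo.restrict_apply, EllTwo.restrict_apply]
  by_cases hk : k ∈ S
  · have : g⁻¹ * k ∉ S := fun hk' => Set.disjoint_left.1 h
      (Set.mem_smul_set_iff_inv_smul_mem.2 hk') hk
    rw [Set.indicator_of_notMem this, inner_zero_left]
  · rw [Set.indicator_of_notMem hk, inner_zero_right]

theorem leftRegular_mul (g h : Γ) : leftRegular (g * h) = leftRegular g * leftRegular h := by
  refine ContinuousLinearMap.ext fun v => lp.ext (funext fun k => ?_)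
  rw [mul_apply_eq_comp, leftRegular_apply, leftRegular_apply, leftRegular_apply,
    mul_inv_rev, mul_assoc]

theorem leftRegular_one : leftRegular (1 : Γ) = 1 := by
  refine ContinuousLinearMap.ext fun v => lp.ext (funext fun k => ?_)
  rw [leftRegular_apply, inv_one, one_mul, one_apply_eq_self]

theorem norm_leftRegular_le (g : Γ) : ‖leftRegular g‖ ≤ 1 :=
  LinearIsometry.norm_toContinuousLinearMap_le _

theorem star_leftRegular (g : Γ) : star (leftRegular g) = leftRegular g⁻¹ := by
  rw [ContinuousLinearMap.star_eq_adjoint]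
  refine ((ContinuousLinearMap.eq_adjoint_iff _ _).2 fun v w => ?_).symm
  rw [lp.inner_eq_tsum, lp.inner_eq_tsum, ← (Equiv.mulLeft g⁻¹).tsum_eq]
  refine tsum_congr fun k => ?_
  change inner ℂ (v (g⁻¹⁻¹ * (g⁻¹ * k))) (w (g⁻¹ * k)) = inner ℂ (v k) (w (g⁻¹ * k))
  rw [inv_inv, mul_inv_cancel_left]

/-- The left regular representation as a homomorphism. -/
noncomputable def leftRegularHom (Γ : Type*) [Group Γ] : Γ →* (EllTwo Γ →L[ℂ] EllTwo Γ) where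
  toFun := leftRegular
  map_one' := leftRegular_one
  map_mul' := leftRegular_mul

/-- The operators λ(g) are closed under products and adjoints, so their linear span is already a
star algebra. -/
theorem mem_adjoin_leftRegular {b : EllTwo Γ →L[ℂ] EllTwo Γ} :
    b ∈ StarAlgebra.adjoin ℂ (Set.range (leftRegular (Γ := Γ))) ↔
      ∃ c : Γ →₀ ℂ, (c.sum fun g a => a • leftRegular g) = b := by
  rw [← Finsupp.mem_span_range_iff_exists_finsupp]
  have hstar : star (Set.range (leftRegular (Γ := Γ))) ⊆ Set.range (leftRegular (Γ := Γ)) := by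
    rintro a ⟨g, hg⟩
    exact ⟨g⁻¹, by rw [← star_leftRegular, hg, star_star]⟩
  have h := StarAlgebra.adjoin_eq_span (R := ℂ) (Set.range (leftRegular (Γ := Γ)))
  rw [Set.union_eq_self_of_subset_right hstar] at h
  have hc : (Submonoid.closure (Set.range (leftRegular (Γ := Γ))) :
      Set (EllTwo Γ →L[ℂ] EllTwo Γ)) = Set.range (leftRegular (Γ := Γ)) := by
    have := congrArg (fun S : Submonoid (EllTwo Γ →L[ℂ] EllTwo Γ) =>
      (S : Set (EllTwo Γ →L[ℂ] EllTwo Γ)))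
      (Submonoid.closure_eq (MonoidHom.mrange (leftRegularHom Γ)))
    rw [MonoidHom.coe_mrange] at this
    exact this
  rw [hc] at h
  rw [← h]
  rfl

/-- Left translations commute with right ones, so matrix coefficients depend only on hg⁻¹. The
condition is closed, so it is checked on finite sums of λ(k). -/
theorem apply_delta_apply {a : EllTwo Γ →L[ℂ] EllTwo Γ} (ha : a ∈ reducedCStarAlgebra Γ)
    (g h : Γ) : a (EllTwo.delta g) h = a (EllTwo.delta 1) (h * g⁻¹) := by
  classical
  have hcont : ∀ g h : Γ, Continuous fun a : EllTwo Γ →L[ℂ] EllTwo Γ => a (EllTwo.delta g) h :=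
    fun g h => (lp.lipschitzWith_one_eval 2 h).continuous.comp (by fun_prop)
  have hcl : IsClosed {a : EllTwo Γ →L[ℂ] EllTwo Γ |
      a (EllTwo.delta g) h = a (EllTwo.delta 1) (h * g⁻¹)} := isClosed_eq (hcont _ _) (hcont _ _)
  refine closure_minimal ?_ hcl ha
  intro b hb
  obtain ⟨c, rfl⟩ := mem_adjoin_leftRegular.1 hb
  simp only [Set.mem_ofPred_eq, Finsupp.sum, _root_.sum_apply,
    _root_.smul_apply, lp.coeFn_sum, Finset.sum_apply, lp.coeFn_smul, Pi.smul_apply]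
  refine Finset.sum_congr rfl fun k _ => ?_
  rw [leftRegular_apply, leftRegular_apply, EllTwo.delta_apply, EllTwo.delta_apply, ← mul_assoc,
    mul_inv_eq_one]

/-- The canonical trace is faithful. -/
theorem eq_zero_of_apply_delta_one {a : EllTwo Γ →L[ℂ] EllTwo Γ} (ha : a ∈ reducedCStarAlgebra Γ)
    (h : a (EllTwo.delta 1) = 0) : a = 0 := by
  classical
  have hd : ∀ g, a (EllTwo.delta g) = 0 := fun g => lp.ext (funext fun k => by
    rw [apply_delta_apply ha, h]
    rfl)
  refine ContinuousLinearMap.ext fun v => ?_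
  have h1 := (lp.hasSum_single (p := 2) (by norm_num) v).mapL a
  have h2 : (fun g => a (lp.single 2 g (v g))) = 0 := funext fun g => by
    have : (lp.single 2 g (v g) : EllTwo Γ) = v g • EllTwo.delta g := by
      rw [EllTwo.delta, ← lp.single_smul]
      congr
      simp
    rw [this, map_smul, hd, smul_zero]
    rfl
  rw [h2] at h1
  exact h1.unique hasSum_zero

/-- Conjugation of an operator by the left regular representation. -/
noncomputable def conjLeftRegular (g : Γ) (a : EllTwo Γ →L[ℂ] EllTwo Γ) :
    EllTwo Γ →L[ℂ] EllTwo Γ :=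
  leftRegular g * a * leftRegular g⁻¹

theorem conjLeftRegular_one (g : Γ) : conjLeftRegular g 1 = 1 := by
  rw [conjLeftRegular, mul_one, ← leftRegular_mul, mul_inv_cancel, leftRegular_one]

theorem conjLeftRegular_add (g : Γ) (a b : EllTwo Γ →L[ℂ] EllTwo Γ) :
    conjLeftRegular g (a + b) = conjLeftRegular g a + conjLeftRegular g b := by
  simp only [conjLeftRegular, mul_add, add_mul]

theorem conjLeftRegular_smul (g : Γ) (c : ℂ) (a : EllTwo Γ →L[ℂ] EllTwo Γ) :
    conjLeftRegular g (c • a) = c • conjLeftRegular g a := by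
  simp only [conjLeftRegular, mul_smul_comm, smul_mul_assoc]

theorem norm_conjLeftRegular_le (g : Γ) (a : EllTwo Γ →L[ℂ] EllTwo Γ) :
    ‖conjLeftRegular g a‖ ≤ ‖a‖ := by
  calc ‖conjLeftRegular g a‖ ≤ ‖leftRegular g‖ * ‖a‖ * ‖leftRegular g⁻¹‖ :=
        (norm_mul_le _ _).trans (by gcongr; exact norm_mul_le _ _)
    _ ≤ 1 * ‖a‖ * 1 := by
        gcongr
        · exact norm_leftRegular_le g
        · exact norm_leftRegular_le g⁻¹
    _ = ‖a‖ := by ring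

/-- Powers' averaging estimate. -/
theorem IsPowersGroup.exists_norm_sum_conj_le (hΓ : IsPowersGroup Γ) (F : Finset Γ)
    (hF : (1 : Γ) ∉ F) (c : Γ → ℂ) {N : ℕ} (hN : 1 ≤ N) :
    ∃ γ : Fin N → Γ, ‖∑ j, conjLeftRegular (γ j) (∑ f ∈ F, c f • leftRegular f)‖ ≤
      2 * (√N * ‖∑ f ∈ F, c f • leftRegular f‖) := by
  obtain ⟨C, D, γ, hCD, hdisj, hC, hD⟩ := hΓ.2 F hF N hN
  refine ⟨γ, norm_sum_le_of_offDiagonal _ (fun j => EllTwo.restrict (γ j • D))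
    (fun j => EllTwo.restrict (γ j • C)) (fun j => norm_conjLeftRegular_le _ _) (fun j v => ?_)
    (fun j v => EllTwo.norm_restrict_le _ v) (EllTwo.sum_norm_restrict_sq_le _ hD)
    (fun j v w => ?_) (norm_nonneg _)⟩
  · refine EllTwo.restrict_add_restrict ?_ ?_ v
    · rw [← Set.smul_set_union, hCD, Set.smul_set_univ]
    · exact Set.disjoint_smul_set.2 hdisj
  · simp only [conjLeftRegular, Finset.mul_sum, Finset.sum_mul, mul_smul_comm, smul_mul_assoc,
      _root_.sum_apply, _root_.smul_apply, sum_inner, inner_smul_left]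
    refine Finset.sum_eq_zero fun f hf => ?_
    rw [← leftRegular_mul, ← leftRegular_mul, inner_leftRegular_restrict, mul_zero]
    -- The conjugate γfγ⁻¹ displaces γC because f displaces C.
    rw [mul_smul, mul_smul, inv_smul_smul, Set.disjoint_smul_set]
    exact hC f hf

/-- An element of the reduced C*-algebra with trace one can be averaged to be close to `1`. -/
theorem IsPowersGroup.exists_norm_average_sub_one_le (hΓ : IsPowersGroup Γ)
    {a : EllTwo Γ →L[ℂ] EllTwo Γ} (ha : a ∈ reducedCStarAlgebra Γ)
    (ha1 : a (EllTwo.delta 1) 1 = 1) {ε : ℝ} (hε : 0 < ε) :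
    ∃ (N : ℕ) (γ : Fin N → Γ), ‖(N : ℂ)⁻¹ • ∑ j, conjLeftRegular (γ j) a - 1‖ ≤ 3 * ε := by
  classical
  have ha' : a ∈ closure ((StarAlgebra.adjoin ℂ (Set.range (leftRegular (Γ := Γ))) :
      StarSubalgebra ℂ (EllTwo Γ →L[ℂ] EllTwo Γ)) : Set (EllTwo Γ →L[ℂ] EllTwo Γ)) := ha
  obtain ⟨b, hb, hab⟩ := Metric.mem_closure_iff.1 ha' ε hε
  obtain ⟨c, rfl⟩ := mem_adjoin_leftRegular.1 hb
  set x := ∑ f ∈ c.support.erase 1, c f • leftRegular f with hx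
  have hsum : (c.sum fun g a => a • leftRegular g) = c 1 • 1 + x := by
    rw [← leftRegular_one, hx, Finsupp.sum]
    by_cases h1 : (1 : Γ) ∈ c.support
    · rw [Finset.add_sum_erase _ (fun g => c g • leftRegular g) h1]
    · rw [Finset.erase_eq_of_notMem h1, Finsupp.notMem_support_iff.1 h1, zero_smul, zero_add]
  rw [hsum, dist_eq_norm] at hab
  set d := a - (c 1 • 1 + x) with hd
  have hx1 : x (EllTwo.delta 1) 1 = 0 := by
    simp only [hx, _root_.sum_apply, _root_.smul_apply, lp.coeFn_sum, Finset.sum_apply,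
      lp.coeFn_smul, Pi.smul_apply]
    refine Finset.sum_eq_zero fun g hg => ?_
    rw [leftRegular_apply, EllTwo.delta_apply, mul_one,
      if_neg (inv_ne_one.2 (Finset.ne_of_mem_erase hg)), smul_zero]
  have hc1 : ‖c 1 - 1‖ ≤ ε := by
    have h1 : d (EllTwo.delta 1) 1 = 1 - c 1 := by
      have : d (EllTwo.delta 1) =
          a (EllTwo.delta 1) - (c 1 • EllTwo.delta 1 + x (EllTwo.delta 1)) := by
        simp [hd]
      rw [this, lp.coeFn_sub, Pi.sub_apply, lp.coeFn_add, Pi.add_apply, lp.coeFn_smul,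
        Pi.smul_apply, ha1, hx1, EllTwo.delta_apply, if_pos rfl]
      simp
    rw [norm_sub_rev, ← h1]
    refine (lp.norm_apply_le_norm (by norm_num) _ _).trans ((d.le_opNorm _).trans ?_)
    rw [EllTwo.norm_delta, mul_one]
    exact hab.le
  -- This N makes the averaged Powers bound 2‖x‖/√N at most ε. The other two errors, from
  -- approximating a and from its trace, are at most ε for any N ≥ 1.
  obtain ⟨N, hN⟩ := exists_nat_ge (max 1 ((2 * ‖x‖ / ε) ^ 2))
  have hN1 : 1 ≤ N := by exact_mod_cast (le_max_left _ _).trans hN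
  have hN0 : (0 : ℝ) < N := by exact_mod_cast hN1
  obtain ⟨γ, hγ⟩ := hΓ.exists_norm_sum_conj_le (c.support.erase 1) (Finset.notMem_erase _ _) c hN1
  rw [← hx] at hγ
  have hxN : 2 * ‖x‖ ≤ ε * √N := by
    rw [← div_le_iff₀' hε]
    exact Real.le_sqrt_of_sq_le ((le_max_right _ _).trans hN)
  refine ⟨N, γ, ?_⟩
  have hNC : (N : ℂ) ≠ 0 := by exact_mod_cast hN0.ne'
  have hdecomp : (N : ℂ)⁻¹ • ∑ j, conjLeftRegular (γ j) a - 1 =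
      (N : ℂ)⁻¹ • ∑ j, conjLeftRegular (γ j) d + (c 1 - 1) • 1 +
        (N : ℂ)⁻¹ • ∑ j, conjLeftRegular (γ j) x := by
    have hconj : ∀ j, conjLeftRegular (γ j) a =
        conjLeftRegular (γ j) d + c 1 • 1 + conjLeftRegular (γ j) x := fun j => by
      conv_lhs => rw [show a = d + c 1 • 1 + x by rw [hd]; abel]
      rw [conjLeftRegular_add, conjLeftRegular_add, conjLeftRegular_smul, conjLeftRegular_one]
    simp only [hconj, Finset.sum_add_distrib, smul_add, Finset.sum_const, Finset.card_univ,
      Fintype.card_fin]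
    rw [← Nat.cast_smul_eq_nsmul ℂ, inv_smul_smul₀ hNC, sub_smul, one_smul]
    abel
  have hnorm : ∀ v : EllTwo Γ →L[ℂ] EllTwo Γ, ‖(N : ℂ)⁻¹ • v‖ = ‖v‖ / N := fun v => by
    rw [norm_smul, norm_inv, Complex.norm_natCast, inv_mul_eq_div]
  rw [hdecomp, show 3 * ε = ε + ε + ε by ring]
  refine norm_add₃_le.trans (add_le_add (add_le_add ?_ ?_) ?_)
  · rw [hnorm, div_le_iff₀ hN0]
    refine (norm_sum_le _ _).trans ((Finset.sum_le_card_nsmul _ _ ε fun j _ =>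
      (norm_conjLeftRegular_le _ _).trans hab.le).trans ?_)
    rw [Finset.card_univ, Fintype.card_fin, nsmul_eq_mul, mul_comm]
  · rw [norm_smul]
    refine (mul_le_of_le_one_right (norm_nonneg _) ?_).trans hc1
    exact ContinuousLinearMap.norm_id_le
  · rw [hnorm, div_le_iff₀ hN0]
    calc _ ≤ 2 * (√N * ‖x‖) := hγ
      _ = √N * (2 * ‖x‖) := by ring
      _ ≤ √N * (ε * √N) := by gcongr
      _ = ε * (√N * √N) := by ring
      _ = ε * N := by rw [Real.mul_self_sqrt hN0.le]

theorem leftRegular_mem (g : Γ) : leftRegular g ∈ reducedCStarAlgebra Γ :=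
  StarSubalgebra.le_topologicalClosure _ (StarAlgebra.subset_adjoin ℂ _ ⟨g, rfl⟩)

/-- Powers groups are C*-simple. -/
theorem IsPowersGroup.isCStarSimple (hΓ : IsPowersGroup Γ) : IsCStarSimple Γ := by
  classical
  intro I hI
  refine or_iff_not_imp_left.2 fun hne => (TwoSidedIdeal.one_mem_iff I).1 ?_
  obtain ⟨x, hxI, hx0⟩ : ∃ x ∈ I, x ≠ 0 := by
    by_contra! h
    refine hne (le_antisymm (fun x hx => ?_) bot_le)
    rw [h x hx]
    exact zero_mem _
  -- The trace of x*x is ‖xδ₁‖², non-zero by faithfulness, so x*x can be normalised to trace one.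
  set t : ℂ := (star x * x).1 (EllTwo.delta 1) 1 with ht
  have hinner : ∀ v : EllTwo Γ, v 1 = inner ℂ (EllTwo.delta 1) v := fun v => by
    rw [EllTwo.delta, lp.inner_single_left]
    simp
  have ht0 : t ≠ 0 := by
    have h1 : t = inner ℂ (x.1 (EllTwo.delta 1)) (x.1 (EllTwo.delta 1)) := by
      rw [ht, hinner]
      change inner ℂ (EllTwo.delta 1)
        (ContinuousLinearMap.adjoint x.1 (x.1 (EllTwo.delta 1))) = _
      rw [ContinuousLinearMap.adjoint_inner_right]
    rw [h1, inner_self_ne_zero]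
    exact fun h => hx0 (Subtype.ext (eq_zero_of_apply_delta_one x.2 h))
  have hsmul : ∀ (c : ℂ) {y : reducedCStarAlgebra Γ}, y ∈ I → c • y ∈ I := fun c y hy => by
    rw [Algebra.smul_def]
    exact I.mul_mem_left _ _ hy
  set y : reducedCStarAlgebra Γ := t⁻¹ • (star x * x) with hy
  have hyI : y ∈ I := hsmul _ (I.mul_mem_left _ _ hxI)
  have hy1 : y.1 (EllTwo.delta 1) 1 = 1 := inv_mul_cancel₀ ht0
  have hmem : (1 : reducedCStarAlgebra Γ) ∈ closure (I : Set (reducedCStarAlgebra Γ)) := by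
    refine Metric.mem_closure_iff.2 fun ε hε => ?_
    -- With ε / 4 the bound 3ε/4 is strictly below ε.
    obtain ⟨N, γ, hγ⟩ := hΓ.exists_norm_average_sub_one_le y.2 hy1 (show 0 < ε / 4 by positivity)
    refine ⟨(N : ℂ)⁻¹ • ∑ j, (⟨leftRegular (γ j), leftRegular_mem _⟩ * y *
      ⟨leftRegular (γ j)⁻¹, leftRegular_mem _⟩), hsmul _ (TwoSidedIdeal.finsetSum_mem I _ _
        fun j _ => I.mul_mem_right _ _ (I.mul_mem_left _ _ hyI)), ?_⟩
    rw [dist_comm, Subtype.dist_eq, dist_eq_norm]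
    refine lt_of_le_of_lt (le_of_eq_of_le ?_ hγ) (by linarith)
    congr 2
    simp [conjLeftRegular]
  rw [hI.closure_eq] at hmem
  exact hmem

end Regular

end TreeAction

theorem mainTheorem6 {Γ : Type*} [Group Γ] {V : Type*} [MulAction Γ V] (T : SimpleGraph V)
    [TreeAction.ActsOnGraph Γ T] (hT : T.IsTree)
    (hmin : TreeAction.IsMinimalTreeAction Γ T) (hhyp : TreeAction.IsStronglyHyperbolic Γ T) :
    List.TFAE
      [ TreeAction.interiorSubgroup Γ (TreeAction.Boundary T) = ⊥,
        TreeAction.IsStronglyFaithful Γ V,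
        TreeAction.IsStronglyFaithful Γ (TreeAction.Boundary T),
        TreeAction.IsTopologicallyFree Γ (TreeAction.Boundary T),
        TreeAction.IsSlender Γ T,
        ∀ H : Set V, TreeAction.IsHalfTree T H → fixingSubgroup Γ H = ⊥,
        ∃ H : Set V, TreeAction.IsHalfTree T H ∧ fixingSubgroup Γ H = ⊥ ] ∧
    (TreeAction.interiorSubgroup Γ (TreeAction.Boundary T) = ⊥ →
      TreeAction.IsPowersGroup Γ ∧ TreeAction.IsCStarSimple Γ) := by
  have h := TreeAction.tfae_boundary_action hT hmin hhyp
  refine ⟨h, fun h1 => ?_⟩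
  have h6 := (h.out 0 5).1 h1
  have hP : TreeAction.IsPowersGroup Γ :=
    TreeAction.isPowersGroup_of_fixingSubgroup_eq_bot hT hmin hhyp fun a b hab =>
      h6 _ ((TreeAction.isHalfTree_iff hT).2 ⟨a, b, hab, rfl⟩)
  exact ⟨hP, hP.isCStarSimple⟩
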